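/- **Theorem (Morita invariance of $\mathbf Z_2$-graded Čech cohomology).** All algebras are over $\mathbf C$. *Definitions.* Let $(\mathcal C,J)$ be a category with a Grothendieck topology, $X$ an object of $\mathcal C$, and $M$ a presheaf (for instance a sheaf) of complex vector spaces on $\mathcal C$. For a family $\mathcal U=(U_i\to X)_{i\in I}$ put $$C^k(\mathcal U,M)=\prod_{(i_0,\dots,i_k)\in I^{k+1}}M(U_{i_0}\times_X\cdots\times_XU_{i_k}),\qquad k\ge 0,$$ where the value of $M$ on a fibre product means $\mathrm{Hom}(h_{U_{i_0}}\times_{h_X}\cdots\times_{h_X}h_{U_{i_k}},M)$ (the usual value when the fibre product exists in $\mathcal C$). Let $d_s:C^k\to C^{k+1}$ be the map that omits the $s$-th index, and put $$b=\sum_{s=0}^{k+1}(-1)^sd_s,\quad b'=\sum_{s=0}^{k}(-1)^sd_s,\quad (\lambda c)_{i_0\dots i_k}=(-1)^kc_{i_ki_0\dots i_{k-1}},\quad N=1+\lambda+\dots+\lambda^k .$$ The periodic Čech bicomplex has $C^j(\mathcal U,M)$ in row $j\ge0$ of every column, with columns taken modulo $2$; the vertical differential is $b$ in the even columns and $-b'$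 in the odd ones, and the horizontal differential is $1-\lambda$ out of the even columns and $N$ out of the odd ones. Its total complex is $\mathbf Z/2$-graded: in parity $p$ it is the direct product $\prod_{j\ge 0}C^j$, respectively the direct sum $\bigoplus_{j\ge0}C^j$, where $C^j$ is placed in the column of parity $p-j$. Its cohomology is $\mathbf Z_2\check H^p(\mathcal U,M)$, and $$\mathbf Z_2\check H^p(X,M)=\varinjlim_{\mathcal U}\mathbf Z_2\check H^p(\mathcal U,M),\qquad p\in\mathbf Z/2,$$ the direct limit over the covering families of $X$ (those generating a covering sieve) and their refinements; it depends on $J$. It is functorial in $M$ and, by restriction, in $X$. For a unital algebra $A$ let $\mathcal A$ be the category of $A$-modules; for a C*-algebra $A$ (unital or not) one may also take for $\mathcal A$ the category of non-degenerate $*$-representations of $A$ on Hilbert spaces, with bounded intertwining operators as morphisms. The $\mathbf Z_2$-graded Čech cohomology $\mathbf Z_2\check H^*(A)$ of $A$ is the $\mathbf Z_2$-graded Čech cohomology of the category $\mathcal A$, that is, the functor $(J,X,M)\mapsto\mathbf Z_2\check H^*(X,M)$ of topologies $J$ on $\mathcal A$, objects $X$ and coefficients $M$. *Statement.* Let $n\ge1$,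 and let $A$ be a unital algebra, with $\mathcal A$ and $\mathcal B$ the categories of modules over $A$ and over $A\otimes\mathrm{Mat}_n(\mathbf C)$; or let $A$ be a C*-algebra, with $\mathcal A$ and $\mathcal B$ the categories of non-degenerate $*$-representations of $A$ and of $A\otimes\mathrm{Mat}_n(\mathbf C)$. Then $$\mathbf Z_2\check H^*(A\otimes\mathrm{Mat}_n(\mathbf C))\cong\mathbf Z_2\check H^*(A),$$ in the following sense. There are an equivalence of categories $e:\mathcal A\to\mathcal B$ and a bijection $J\mapsto J'$ from the Grothendieck topologies on $\mathcal A$ to those on $\mathcal B$, such that a sieve on $eX$ is in $J'$ if and only if its inverse image under $e$ is a covering sieve of $X$ in $J$, such that the canonical topology corresponds to the canonical topology, and such that $M$ is a $J'$-sheaf if and only if $M\circ e$ is a $J$-sheaf; and, for all $J$, all objects $X$ of $\mathcal A$, all presheaves $M$ of complex vector spaces on $\mathcal B$ and both parities $p$, there are isomorphisms $$\mathbf Z_2\check H^p(eX,M)\ (\text{for }J')\;\cong\;\mathbf Z_2\check H^p(X,M\circ e)\ (\text{for }J),$$ natural in $M$ and in $X$. This holds for the total complexes formed with direct products and for those formed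 with direct sums. -/

import Mathlib

open CategoryTheory Opposite
open scoped TensorProduct

noncomputable section

namespace CechZ2

universe t t' w v u

/-! ### Families of morphisms and their fibre products -/

section Families

variable {C : Type u} [Category.{v} C]

/-- A family `(U i ⟶ X)` of morphisms with common target `X`. -/
structure Family (X : C) where
  /-- the index set -/
  I : Type t
  /-- the sources -/
  U : I → C
  /-- the morphisms -/
  f : ∀ i, U i ⟶ X

/-- The `Y`-points of the fibre product `U (i 0) ×_X ⋯ ×_X U (i k)`: this is the value at `Y` of the
fibre product over `h_X` of the presheaves `h_{U (i s)}`. -/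
@[ext] structure Pt {X : C} (F : Family.{t} X) {k : ℕ} (i : Fin (k + 1) → F.I) (Y : C) where
  /-- the components -/
  g : ∀ s, Y ⟶ F.U (i s)
  /-- all composites to `X` agree -/
  w : ∀ r s, g r ≫ F.f (i r) = g s ≫ F.f (i s)

variable {X : C} {F : Family.{t} X}

/-- Restriction of a point of the fibre product along `h : Y' ⟶ Y`. -/
@[simps] def Pt.comp {k : ℕ} {i : Fin (k + 1) → F.I} {Y Y' : C} (g : Pt F i Y) (h : Y' ⟶ Y) :
    Pt F i Y' where
  g s := h ≫ g.g s
  w r s := by simp only [Category.assoc, g.w r s]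

/-- The morphism `U (i 0) × ⋯ × U (i m) ⟶ U (i (α 0)) × ⋯ × U (i (α k))` defined by a map `α` of
positions, on `Y`-points. -/
@[simps] def Pt.reindex {k m : ℕ} {i : Fin (m + 1) → F.I} {Y : C} (g : Pt F i Y)
    (α : Fin (k + 1) → Fin (m + 1)) : Pt F (i ∘ α) Y where
  g s := g.g (α s)
  w r s := g.w (α r) (α s)

/-! ### The Čech cochains and their cyclic structure -/

/-- The submodule of natural families that underlies `Cochain`. -/
def cochainSubmodule (F : Family.{t} X) (G : Cᵒᵖ ⥤ ModuleCat.{w} ℂ) (k : ℕ) :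
    Submodule ℂ (∀ (i : Fin (k + 1) → F.I) (Y : C), Pt F i Y → G.obj (op Y)) where
  carrier := {c | ∀ (i : Fin (k + 1) → F.I) (Y Y' : C) (h : Y' ⟶ Y) (g : Pt F i Y),
    (G.map h.op).hom (c i Y g) = c i Y' (g.comp h)}
  add_mem' := fun ha hb i Y Y' h g => by simp [ha i Y Y' h g, hb i Y Y' h g]
  zero_mem' := fun i Y Y' h g => by simp
  smul_mem' := fun a c hc i Y Y' h g => by simp [hc i Y Y' h g]

/-- The Čech cochains of degree `k`, that is `∏_{(i_0, …, i_k)} G (U i_0 × ⋯ × U i_k)`, where the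
value of `G` on the fibre product over `X` is `Hom (h_{U i_0} ×_{h_X} ⋯ ×_{h_X} h_{U i_k}, G)`. By
Yoneda's lemma this is the usual value when the fibre products exist in `C`, see
`cochain_eval_bijective`. -/
def Cochain (F : Family.{t} X) (G : Cᵒᵖ ⥤ ModuleCat.{w} ℂ) (k : ℕ) : Type (max t w v u) :=
  cochainSubmodule F G k

instance (F : Family.{t} X) (G : Cᵒᵖ ⥤ ModuleCat.{w} ℂ) (k : ℕ) : AddCommGroup (Cochain F G k) :=
  inferInstanceAs (AddCommGroup (cochainSubmodule F G k))

instance (F : Family.{t} X) (G : Cᵒᵖ ⥤ ModuleCat.{w} ℂ) (k : ℕ) : Module ℂ (Cochain F G k) :=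
  inferInstanceAs (Module ℂ (cochainSubmodule F G k))

variable {G : Cᵒᵖ ⥤ ModuleCat.{w} ℂ}

@[ext] lemma Cochain.ext' {k : ℕ} {c c' : Cochain F G k}
    (h : ∀ (i : Fin (k + 1) → F.I) (Y : C) (g : Pt F i Y), c.1 i Y g = c'.1 i Y g) : c = c' :=
  Subtype.ext (funext fun i => funext fun Y => funext fun g => h i Y g)

/-- If the fibre products `P i = U (i 0) ×_X ⋯ ×_X U (i k)` exist in `C` (with universal points
`p i`), then the cochains of degree `k` are the elements of `∏_i G (P i)`. -/
theorem cochain_eval_bijective {k : ℕ} (P : (Fin (k + 1) → F.I) → C) (p : ∀ i, Pt F i (P i))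
    (hp : ∀ i Y (g : Pt F i Y), ∃! h : Y ⟶ P i, (p i).comp h = g) :
    Function.Bijective
      (fun (c : Cochain F G k) (i : Fin (k + 1) → F.I) => (c.1 i (P i) (p i) : G.obj (op (P i)))) := by
  constructor
  · intro c c' h
    ext i Y g
    obtain ⟨l, rfl, -⟩ := hp i Y g
    rw [← c.2, ← c'.2]
    exact congrArg _ (congrFun h i)
  · intro z
    choose l hl hu using hp
    refine ⟨⟨fun i Y g => (G.map (l i Y g).op).hom (z i), ?_⟩, ?_⟩
    · intro i Y Y' h g
      have e : l i Y' (g.comp h) = h ≫ l i Y g := by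
        refine (hu i Y' (g.comp h) _ ?_).symm
        ext s
        have := congrArg (fun x : Pt F i Y => h ≫ x.g s) (hl i Y g)
        simpa using this
      change _ = (G.map (l i Y' (g.comp h)).op).hom (z i)
      rw [e, op_comp, G.map_comp]
      rfl
    · funext i
      have e : l i (P i) (p i) = 𝟙 _ := by
        refine (hu i (P i) (p i) _ ?_).symm
        ext s
        simp
      simp [e]

/-- The map of cochains `(i_0, …, i_m) ↦ c (i_{α 0}, …, i_{α k})` (followed by restriction to
`U i_0 × ⋯ × U i_m`) defined by a map `α` of positions. -/
def reindex {k m : ℕ} (α : Fin (k + 1) → Fin (m + 1)) : Cochain F G k →ₗ[ℂ] Cochain F G m where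
  toFun c := ⟨fun i Y g => c.1 (i ∘ α) Y (g.reindex α),
    fun i _ _ h g => c.2 (i ∘ α) _ _ h (g.reindex α)⟩
  map_add' _ _ := rfl
  map_smul' _ _ := rfl

lemma reindex_reindex {k m n : ℕ} (α : Fin (k + 1) → Fin (m + 1)) (β : Fin (m + 1) → Fin (n + 1))
    (c : Cochain F G k) : reindex β (reindex α c) = reindex (β ∘ α) c := rfl

/-- The increasing map `{0, …, k} → {0, …, k + 1}` that omits `s`. -/
def face {k : ℕ} (s : ℕ) (r : Fin (k + 1)) : Fin (k + 2) :=
  if r.1 < s then r.castSucc else r.succ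

/-- The cyclic permutation `(i_0, …, i_k) ↦ (i_k, i_0, …, i_{k-1})` on positions. -/
def rot (k : ℕ) (r : Fin (k + 1)) : Fin (k + 1) := r - 1

variable (F G)

/-- The Hochschild differential `b = ∑_{s=0}^{k+1} (-1)^s d_s`, which is the Čech differential. -/
def b (k : ℕ) : Cochain F G k →ₗ[ℂ] Cochain F G (k + 1) :=
  ∑ s ∈ Finset.range (k + 2), (-1 : ℂ) ^ s • reindex (face s)

/-- The differential `b' = ∑_{s=0}^{k} (-1)^s d_s`. -/
def b' (k : ℕ) : Cochain F G k →ₗ[ℂ] Cochain F G (k + 1) :=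
  ∑ s ∈ Finset.range (k + 1), (-1 : ℂ) ^ s • reindex (face s)

/-- The cyclic operator `λ`, with its usual sign:
`(λ c)(i_0, …, i_k) = (-1)^k c (i_k, i_0, …, i_{k-1})`. -/
def lam (k : ℕ) : Module.End ℂ (Cochain F G k) :=
  (-1 : ℂ) ^ k • reindex (rot k)

/-- The norm operator `N = 1 + λ + ⋯ + λ^k`. -/
def norm (k : ℕ) : Module.End ℂ (Cochain F G k) :=
  ∑ m ∈ Finset.range (k + 1), lam F G k ^ m

/-! ### The periodic bicomplex and its total complexes -/

/-- The horizontal differential of the periodic bicomplex out of column `q` (modulo `2`), row `k`: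
`1 - λ` out of the even columns and `N` out of the odd columns. -/
def hor (q : ZMod 2) (k : ℕ) : Module.End ℂ (Cochain F G k) :=
  if q = 0 then 1 - lam F G k else norm F G k

/-- The vertical differential in column `q` (modulo `2`) out of row `k`: it is `b` in the even
columns and `-b'` in the odd columns. -/
def ver (q : ZMod 2) (k : ℕ) : Cochain F G k →ₗ[ℂ] Cochain F G (k + 1) :=
  if q = 0 then b F G k else -b' F G k

/-- The differential of the total complex from parity `p` to parity `p + 1`. In parity `p`, the
entry of row `j` lies in the column of parity `p - j`. -/
def totD (p : ZMod 2) : (∀ j, Cochain F G j) →ₗ[ℂ] (∀ j, Cochain F G j) :=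
  LinearMap.pi fun j => hor F G (p - j) j ∘ₗ LinearMap.proj j +
    match j with
    | 0 => 0
    | j + 1 => ver F G (p - j) j ∘ₗ LinearMap.proj j

/-- The two ways to form the total complex of a bicomplex. -/
inductive Totalization
  /-- direct products -/
  | prod
  /-- direct sums -/
  | sum

/-- The underlying vector space of the total complex (the same in both parities): the direct product
of the rows, or their direct sum. -/
def Tot (T : Totalization) : Submodule ℂ (∀ j, Cochain F G j) :=
  match T with
  | .prod => ⊤
  | .sum =>
    { carrier := {x | ∃ m, ∀ j, m ≤ j → x j = 0}
      add_mem' := fun ⟨m, hm⟩ ⟨n, hn⟩ => ⟨max m n, fun j hj => by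
        simp [hm j (le_trans (le_max_left _ _) hj), hn j (le_trans (le_max_right _ _) hj)]⟩
      zero_mem' := ⟨0, fun _ _ => rfl⟩
      smul_mem' := fun a _ ⟨m, hm⟩ => ⟨m, fun j hj => by simp [hm j hj]⟩ }

/-- The cocycles of parity `p`. -/
def cycles (T : Totalization) (p : ZMod 2) : Submodule ℂ (∀ j, Cochain F G j) :=
  Tot F G T ⊓ LinearMap.ker (totD F G p)

/-- The coboundaries of parity `p` (note that `p + 1 = p - 1`). -/
def boundaries (T : Totalization) (p : ZMod 2) : Submodule ℂ (∀ j, Cochain F G j) :=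
  (Tot F G T).map (totD F G (p + 1))

/-- The `ℤ/2`-graded Čech cohomology of a family of morphisms. -/
def CohFamily (T : Totalization) (p : ZMod 2) : Type (max t w v u) :=
  cycles F G T p ⧸ (boundaries F G T p).submoduleOf (cycles F G T p)

instance (T : Totalization) (p : ZMod 2) : AddCommGroup (CohFamily F G T p) :=
  inferInstanceAs (AddCommGroup (_ ⧸ (boundaries F G T p).submoduleOf (cycles F G T p)))

instance (T : Totalization) (p : ZMod 2) : Module ℂ (CohFamily F G T p) :=
  inferInstanceAs (Module ℂ (_ ⧸ (boundaries F G T p).submoduleOf (cycles F G T p)))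

/-- The cohomology class of a cocycle. -/
def CohFamily.mk (T : Totalization) (p : ZMod 2) : cycles F G T p →ₗ[ℂ] CohFamily F G T p :=
  ((boundaries F G T p).submoduleOf (cycles F G T p)).mkQ

end Families

/-! ### The bicomplex identities -/

section Identities

variable {C : Type u} [Category.{v} C] {X : C} {F : Family.{t} X} {G : Cᵒᵖ ⥤ ModuleCat.{w} ℂ}

lemma rot_val (k : ℕ) (r : Fin (k + 1)) : (rot k r).1 = if r.1 = 0 then k else r.1 - 1 := by
  unfold rot
  split_ifs with h
  · have : r = 0 := Fin.ext h
    subst this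
    cases k <;> simp
  · cases k with
    | zero => omega
    | succ k => exact Fin.val_sub_one_of_ne_zero (fun h' => h (by simp [h']))

lemma alt_sum {M : Type*} [AddCommGroup M] [Module ℂ M] (a : ℕ → ℕ → M)
    (h : ∀ i j, i ≤ j → a (j + 1) i = a i j) (n : ℕ) :
    ∑ i ∈ Finset.range (n + 1), ∑ j ∈ Finset.range n, (-1 : ℂ) ^ (i + j) • a i j = 0 := by
  induction n with
  | zero => simp
  | succ n ih =>
    rw [Finset.sum_range_succ,
      Finset.sum_congr rfl fun i _ => Finset.sum_range_succ (fun j => (-1 : ℂ) ^ (i + j) • a i j) n,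
      Finset.sum_add_distrib, ih, zero_add, ← Finset.sum_add_distrib]
    refine Finset.sum_eq_zero fun i hi => ?_
    rw [h i n (by simpa [Nat.lt_succ_iff] using hi), ← add_smul]
    have : (-1 : ℂ) ^ (i + n) + (-1) ^ (n + 1 + i) = 0 := by ring
    rw [this, zero_smul]

lemma face_val {k : ℕ} (s : ℕ) (r : Fin (k + 1)) :
    (face s r).1 = if r.1 < s then r.1 else r.1 + 1 := by
  unfold face
  split_ifs <;> rfl

lemma face_face (k i j : ℕ) (h : i ≤ j) :
    (face (k := k + 1) (j + 1) ∘ face i : Fin (k + 1) → _) = face i ∘ face j := by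
  funext r
  ext
  simp only [face_val, Function.comp]
  split_ifs <;> omega

theorem b_b (k : ℕ) (c : Cochain F G k) : b F G (k + 1) (b F G k c) = 0 := by
  have := alt_sum (fun i j => reindex (face (k := k + 1) i) (reindex (face j) c))
    (fun i j hij => by simp only [reindex_reindex, face_face k i j hij]) (k + 2)
  rw [b.eq_1 F G (k + 1), LinearMap.sum_apply]
  refine (Finset.sum_congr rfl fun i _ => ?_).trans this
  rw [b, LinearMap.sum_apply, map_sum]
  refine Finset.sum_congr rfl fun j _ => ?_
  rw [LinearMap.smul_apply, LinearMap.smul_apply, map_smul, smul_smul, pow_add]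

theorem b'_b' (k : ℕ) (c : Cochain F G k) : b' F G (k + 1) (b' F G k c) = 0 := by
  have := alt_sum (fun i j => reindex (face (k := k + 1) i) (reindex (face j) c))
    (fun i j hij => by simp only [reindex_reindex, face_face k i j hij]) (k + 1)
  rw [b'.eq_1 F G (k + 1), LinearMap.sum_apply]
  refine (Finset.sum_congr rfl fun i _ => ?_).trans this
  rw [b', LinearMap.sum_apply, map_sum]
  refine Finset.sum_congr rfl fun j _ => ?_
  rw [LinearMap.smul_apply, LinearMap.smul_apply, map_smul, smul_smul, pow_add]

/-- The signed coface operator `(-1)^s d_s`. -/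
def del (F : Family.{t} X) (G : Cᵒᵖ ⥤ ModuleCat.{w} ℂ) (k s : ℕ) :
    Cochain F G k →ₗ[ℂ] Cochain F G (k + 1) :=
  (-1 : ℂ) ^ s • reindex (face s)

lemma lam_del_succ (k s : ℕ) (hs : s ≤ k) (c : Cochain F G k) :
    lam F G (k + 1) (del F G k (s + 1) c) = del F G k s (lam F G k c) := by
  have e : (rot (k + 1) ∘ face (s + 1) : Fin (k + 1) → _) = face s ∘ rot k := by
    funext r
    ext
    have := r.2
    simp only [face_val, Function.comp, rot_val]
    split_ifs <;> first | contradiction | omega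
  simp only [lam, del, LinearMap.smul_apply, map_smul, reindex_reindex, e, smul_smul]
  congr 1
  ring

lemma lam_del_zero (k : ℕ) (c : Cochain F G k) :
    lam F G (k + 1) (del F G k 0 c) = del F G k (k + 1) c := by
  have e : (rot (k + 1) ∘ face 0 : Fin (k + 1) → _) = face (k + 1) := by
    funext r
    ext
    have := r.2
    simp only [face_val, Function.comp, rot_val]
    split_ifs <;> first | contradiction | omega
  simp only [lam, del, LinearMap.smul_apply, map_smul, reindex_reindex, e, smul_smul]
  congr 1
  ring

lemma lam_pow_apply (k m : ℕ) (c : Cochain F G k) :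
    (lam F G k ^ m) c = ((-1 : ℂ) ^ (k * m)) • reindex ((rot k)^[m]) c := by
  induction m with
  | zero =>
    rw [pow_zero, Nat.mul_zero, pow_zero, one_smul]
    rfl
  | succ m ih =>
    rw [pow_succ', Module.End.mul_apply, ih]
    simp only [lam, LinearMap.smul_apply, map_smul, reindex_reindex, smul_smul,
      ← Function.iterate_succ']
    congr 1
    ring

lemma rot_iterate (k : ℕ) : (rot k)^[k + 1] = id := by
  have e : rot k = fun r => r + (-1) := by
    funext r
    rw [rot, sub_eq_add_neg]
  rw [e, add_right_iterate]
  funext r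
  have h : (k + 1) • (-1 : Fin (k + 1)) = 0 := by
    simpa using card_nsmul_eq_zero (x := (-1 : Fin (k + 1)))
  rw [h, add_zero, id]

lemma lam_pow (k : ℕ) : lam F G k ^ (k + 1) = 1 := by
  ext1 c
  rw [lam_pow_apply, Even.neg_one_pow (Nat.even_mul_succ_self k), one_smul, rot_iterate]
  rfl

lemma lam_norm (k : ℕ) : lam F G k * norm F G k = norm F G k := by
  have := mul_neg_geom_sum (lam F G k) (k + 1)
  rw [lam_pow, sub_self, sub_mul, one_mul, sub_eq_zero] at this
  exact this.symm

lemma norm_lam (k : ℕ) : norm F G k * lam F G k = norm F G k := by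
  have := geom_sum_mul_neg (lam F G k) (k + 1)
  rw [lam_pow, sub_self, mul_sub, mul_one, sub_eq_zero] at this
  exact this.symm

lemma b_eq (k : ℕ) : b F G k = ∑ s ∈ Finset.range (k + 2), del F G k s := rfl

lemma b'_eq (k : ℕ) : b' F G k = ∑ s ∈ Finset.range (k + 1), del F G k s := rfl

theorem lam_b (k : ℕ) (c : Cochain F G k) :
    b F G k c - lam F G (k + 1) (b F G k c) = b' F G k (c - lam F G k c) := by
  have h1 : lam F G (k + 1) (b F G k c) = b' F G k (lam F G k c) + del F G k (k + 1) c := by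
    rw [b_eq, b'_eq, Finset.sum_range_succ', LinearMap.add_apply, LinearMap.sum_apply, map_add,
      map_sum, LinearMap.sum_apply, lam_del_zero]
    congr 1
    exact Finset.sum_congr rfl fun s hs =>
      lam_del_succ k s (Nat.lt_succ_iff.1 (Finset.mem_range.1 hs)) c
  have h2 : b F G k c = b' F G k c + del F G k (k + 1) c := by
    rw [b_eq, b'_eq, Finset.sum_range_succ, LinearMap.add_apply]
  rw [h1, h2, map_sub]
  abel

lemma norm_del (k s : ℕ) (hs : s ≤ k + 1) (c : Cochain F G k) :
    norm F G (k + 1) (del F G k s c) = norm F G (k + 1) (del F G k 0 ((lam F G k ^ s) c)) := by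
  induction s generalizing c with
  | zero => rfl
  | succ s ih =>
    rw [pow_succ, Module.End.mul_apply, ← ih (by omega), ← lam_del_succ k s (by omega),
      ← Module.End.mul_apply (norm F G (k + 1)), norm_lam]

lemma del_zero_norm (k s : ℕ) (hs : s ≤ k + 1) (c : Cochain F G k) :
    del F G k 0 (norm F G k c) = (lam F G (k + 1) ^ s) (del F G k s (norm F G k c)) := by
  induction s with
  | zero => rfl
  | succ s ih =>
    rw [ih (by omega), pow_succ, Module.End.mul_apply, lam_del_succ k s (by omega),
      ← Module.End.mul_apply (lam F G k), lam_norm]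

theorem norm_b' (k : ℕ) (c : Cochain F G k) :
    norm F G (k + 1) (b' F G k c) = b F G k (norm F G k c) := by
  have h1 : norm F G (k + 1) (b' F G k c) = norm F G (k + 1) (del F G k 0 (norm F G k c)) := by
    rw [b'_eq, LinearMap.sum_apply, map_sum]
    conv_rhs => rw [norm.eq_1 F G k, LinearMap.sum_apply, map_sum, map_sum]
    exact Finset.sum_congr rfl fun s hs =>
      norm_del k s (by have := Finset.mem_range.1 hs; omega) c
  have h2 : ∀ s ∈ Finset.range (k + 2), del F G k s (norm F G k c) =
      (lam F G (k + 1) ^ (k + 2 - s)) (del F G k 0 (norm F G k c)) := by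
    intro s hs
    have hs := Finset.mem_range.1 hs
    rw [del_zero_norm k s (by omega), ← Module.End.mul_apply, ← pow_add,
      Nat.sub_add_cancel (by omega), lam_pow]
    rfl
  rw [h1, b_eq, LinearMap.sum_apply, Finset.sum_congr rfl h2, ← lam_norm (k + 1),
    norm.eq_1 F G (k + 1), Finset.mul_sum, LinearMap.sum_apply]
  refine (Finset.sum_range_reflect _ _).symm.trans ?_
  refine Finset.sum_congr rfl fun s hs => ?_
  have hs := Finset.mem_range.1 hs
  rw [← pow_succ']
  congr 2
  omega

lemma hor_hor (q : ZMod 2) (k : ℕ) (c : Cochain F G k) :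
    hor F G (q + 1) k (hor F G q k c) = 0 := by
  have h1 : norm F G k * (1 - lam F G k) = 0 := by rw [mul_sub, mul_one, norm_lam, sub_self]
  have h2 : (1 - lam F G k) * norm F G k = 0 := by rw [sub_mul, one_mul, lam_norm, sub_self]
  fin_cases q
  · exact LinearMap.congr_fun h1 c
  · exact LinearMap.congr_fun h2 c

lemma hor_ver (q : ZMod 2) (k : ℕ) (c : Cochain F G k) :
    hor F G q (k + 1) (ver F G q k c) + ver F G (q + 1) k (hor F G q k c) = 0 := by
  fin_cases q
  · change b F G k c - lam F G (k + 1) (b F G k c) + -b' F G k (c - lam F G k c) = 0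
    rw [lam_b, add_neg_cancel]
  · change norm F G (k + 1) (-b' F G k c) + b F G k (norm F G k c) = 0
    rw [map_neg, norm_b', neg_add_cancel]

lemma ver_ver (q : ZMod 2) (k : ℕ) (c : Cochain F G k) :
    ver F G q (k + 1) (ver F G q k c) = 0 := by
  unfold ver
  split_ifs
  · exact b_b k c
  · simp [b'_b']

/-- The total complex is a complex. -/
theorem totD_totD (p : ZMod 2) (x : ∀ j, Cochain F G j) :
    totD F G (p + 1) (totD F G p x) = 0 := by
  have e : ∀ j : ℕ, p + 1 - ((j + 1 : ℕ) : ZMod 2) = p - j := fun j => by push_cast; ring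
  have e' : ∀ j : ℕ, p - (j : ZMod 2) = p - ((j + 1 : ℕ) : ZMod 2) + 1 :=
    fun j => by push_cast; ring
  have e'' : ∀ j : ℕ, p + 1 - (j : ZMod 2) = p - j + 1 := fun j => by ring
  funext j
  match j with
  | 0 =>
    change hor F G (p + 1 - _) 0 (hor F G (p - _) 0 (x 0) + 0) + 0 = 0
    rw [add_zero, add_zero, e'', hor_hor]
  | 1 =>
    change hor F G (p + 1 - ((0 + 1 : ℕ) : ZMod 2)) 1
      (hor F G (p - ((0 + 1 : ℕ) : ZMod 2)) 1 (x 1) + ver F G (p - ((0 : ℕ) : ZMod 2)) 0 (x 0)) +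
      ver F G (p + 1 - ((0 : ℕ) : ZMod 2)) 0 (hor F G (p - ((0 : ℕ) : ZMod 2)) 0 (x 0) + 0) = 0
    rw [e, add_zero, e'', map_add, add_assoc, hor_ver, add_zero, e', hor_hor]
  | j + 2 =>
    change hor F G (p + 1 - ((j + 1 + 1 : ℕ) : ZMod 2)) (j + 2)
      (hor F G (p - ((j + 1 + 1 : ℕ) : ZMod 2)) (j + 2) (x (j + 2)) +
        ver F G (p - ((j + 1 : ℕ) : ZMod 2)) (j + 1) (x (j + 1))) +
      ver F G (p + 1 - ((j + 1 : ℕ) : ZMod 2)) (j + 1)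
        (hor F G (p - ((j + 1 : ℕ) : ZMod 2)) (j + 1) (x (j + 1)) +
          ver F G (p - (j : ZMod 2)) j (x j)) = 0
    rw [map_add, map_add, e j, ver_ver, add_zero, e (j + 1), e' (j + 1), hor_hor, zero_add, ← e' (j + 1),
      e' j, hor_ver]

end Identities

/-! ### Functoriality -/

section Functoriality

variable {C : Type u} [Category.{v} C]

/-- A morphism from a family over `X'` to a family over `X` that lies over `h : X' ⟶ X`. For `h = 𝟙`
this is a refinement. -/
structure Family.Hom {X' X : C} (F' : Family.{t'} X') (F : Family.{t} X) (h : X' ⟶ X) where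
  /-- the map of index sets -/
  idx : F'.I → F.I
  /-- the morphisms on the sources -/
  φ : ∀ j, F'.U j ⟶ F.U (idx j)
  /-- compatibility with `h` -/
  comm : ∀ j, φ j ≫ F.f (idx j) = F'.f j ≫ h

variable {X' X : C} {F' : Family.{t'} X'} {F : Family.{t} X} {h : X' ⟶ X}
  {G G' : Cᵒᵖ ⥤ ModuleCat.{w} ℂ}

/-- The induced morphism of fibre products, on `Y`-points. -/
@[simps] def Pt.push (φ : F'.Hom F h) {k : ℕ} {i : Fin (k + 1) → F'.I} {Y : C} (g : Pt F' i Y) :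
    Pt F (φ.idx ∘ i) Y where
  g s := g.g s ≫ φ.φ (i s)
  w r s := by
    have := g.w r s
    simp only [Function.comp, Category.assoc, φ.comm]
    rw [← Category.assoc, this, Category.assoc]

/-- The map of cochains induced by a morphism of families and a morphism of coefficients. -/
def cochainMap (φ : F'.Hom F h) (η : G ⟶ G') (k : ℕ) : Cochain F G k →ₗ[ℂ] Cochain F' G' k where
  toFun c := ⟨fun i Y g => (η.app (op Y)).hom (c.1 (φ.idx ∘ i) Y (g.push φ)), by
    intro i Y Y' l g
    have e : (g.comp l).push φ = (g.push φ).comp l := by ext s; simp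
    change _ = (η.app (op Y')).hom (c.1 (φ.idx ∘ i) Y' ((g.comp l).push φ))
    rw [e, ← c.2]
    exact (congrArg (fun f => f.hom (c.1 (φ.idx ∘ i) Y (g.push φ))) (η.naturality l.op)).symm⟩
  map_add' c c' := Cochain.ext' fun i Y g =>
    map_add (η.app (op Y)).hom (c.1 (φ.idx ∘ i) Y (g.push φ)) (c'.1 (φ.idx ∘ i) Y (g.push φ))
  map_smul' a c := Cochain.ext' fun i Y g =>
    map_smul (η.app (op Y)).hom a (c.1 (φ.idx ∘ i) Y (g.push φ))

/-- The induced map on the entries of the total complexes. -/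
def totMap (φ : F'.Hom F h) (η : G ⟶ G') : (∀ j, Cochain F G j) →ₗ[ℂ] (∀ j, Cochain F' G' j) :=
  LinearMap.pi fun j => cochainMap φ η j ∘ₗ LinearMap.proj j

lemma cochainMap_reindex (φ : F'.Hom F h) (η : G ⟶ G') {k m : ℕ} (α : Fin (k + 1) → Fin (m + 1))
    (c : Cochain F G k) :
    cochainMap φ η m (reindex α c) = reindex α (cochainMap φ η k c) := rfl

lemma cochainMap_lam (φ : F'.Hom F h) (η : G ⟶ G') (k : ℕ) (c : Cochain F G k) :
    cochainMap φ η k (lam F G k c) = lam F' G' k (cochainMap φ η k c) := by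
  simp [lam, cochainMap_reindex]

lemma cochainMap_lam_pow (φ : F'.Hom F h) (η : G ⟶ G') (k n : ℕ) (c : Cochain F G k) :
    cochainMap φ η k ((lam F G k ^ n) c) = (lam F' G' k ^ n) (cochainMap φ η k c) := by
  induction n with
  | zero => rfl
  | succ n ih => rw [pow_succ', pow_succ', Module.End.mul_apply, Module.End.mul_apply,
      cochainMap_lam, ih]

lemma cochainMap_hor (φ : F'.Hom F h) (η : G ⟶ G') (q : ZMod 2) (k : ℕ) (c : Cochain F G k) :
    cochainMap φ η k (hor F G q k c) = hor F' G' q k (cochainMap φ η k c) := by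
  unfold hor
  split_ifs
  · simp [cochainMap_lam]
  · simp [norm, cochainMap_lam_pow]

lemma cochainMap_ver (φ : F'.Hom F h) (η : G ⟶ G') (q : ZMod 2) (k : ℕ) (c : Cochain F G k) :
    cochainMap φ η (k + 1) (ver F G q k c) = ver F' G' q k (cochainMap φ η k c) := by
  unfold ver
  split_ifs
  · simp [b, cochainMap_reindex]
  · simp [b', cochainMap_reindex]

lemma totMap_totD (φ : F'.Hom F h) (η : G ⟶ G') (p : ZMod 2) (x : ∀ j, Cochain F G j) :
    totMap φ η (totD F G p x) = totD F' G' p (totMap φ η x) := by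
  funext j
  cases j with
  | zero => simp [totMap, totD, cochainMap_hor]
  | succ j => simp [totMap, totD, cochainMap_hor, cochainMap_ver]

lemma totMap_mem (φ : F'.Hom F h) (η : G ⟶ G') (T : Totalization) (x : ∀ j, Cochain F G j)
    (hx : x ∈ Tot F G T) : totMap φ η x ∈ Tot F' G' T := by
  cases T with
  | prod => trivial
  | sum =>
    obtain ⟨m, hm⟩ := hx
    exact ⟨m, fun j hj => by simp [totMap, hm j hj]⟩

/-- The induced map on cocycles. -/
def cyclesMap (φ : F'.Hom F h) (η : G ⟶ G') (T : Totalization) (p : ZMod 2) :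
    cycles F G T p →ₗ[ℂ] cycles F' G' T p :=
  (totMap φ η).restrict fun x hx => ⟨totMap_mem φ η T x hx.1, by
    change totD F' G' p (totMap φ η x) = 0
    rw [← totMap_totD, LinearMap.mem_ker.1 hx.2, map_zero]⟩

/-- The induced map on the `ℤ/2`-graded Čech cohomology of families. -/
def cohFamilyMap (φ : F'.Hom F h) (η : G ⟶ G') (T : Totalization) (p : ZMod 2) :
    CohFamily F G T p →ₗ[ℂ] CohFamily F' G' T p :=
  Submodule.mapQ ((boundaries F G T p).submoduleOf (cycles F G T p))
    ((boundaries F' G' T p).submoduleOf (cycles F' G' T p)) (cyclesMap φ η T p) (by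
    rintro ⟨x, hx⟩ ⟨y, hy, hyx⟩
    refine ⟨totMap φ η y, totMap_mem φ η T y hy, ?_⟩
    rw [← totMap_totD, hyx]
    rfl)

lemma cohFamilyMap_square {X₁ X₂ X₃ X₄ : C} {F₁ : Family.{t} X₁} {F₂ : Family.{t} X₂}
    {F₃ : Family.{t} X₃} {F₄ : Family.{t} X₄} {h₁ : X₂ ⟶ X₁} {h₂ : X₄ ⟶ X₂} {h₃ : X₃ ⟶ X₁}
    {h₄ : X₄ ⟶ X₃} {G₁ G₂ G₃ G₄ : Cᵒᵖ ⥤ ModuleCat.{w} ℂ}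
    (φ₁ : F₂.Hom F₁ h₁) (φ₂ : F₄.Hom F₂ h₂) (φ₃ : F₃.Hom F₁ h₃) (φ₄ : F₄.Hom F₃ h₄)
    (η₁ : G₁ ⟶ G₂) (η₂ : G₂ ⟶ G₄) (η₃ : G₁ ⟶ G₃) (η₄ : G₃ ⟶ G₄)
    (H : ∀ j (c : Cochain F₁ G₁ j), cochainMap φ₂ η₂ j (cochainMap φ₁ η₁ j c) =
      cochainMap φ₄ η₄ j (cochainMap φ₃ η₃ j c))
    (T : Totalization) (p : ZMod 2) (x : CohFamily F₁ G₁ T p) :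
    cohFamilyMap φ₂ η₂ T p (cohFamilyMap φ₁ η₁ T p x) =
      cohFamilyMap φ₄ η₄ T p (cohFamilyMap φ₃ η₃ T p x) := by
  obtain ⟨x, rfl⟩ := Submodule.Quotient.mk_surjective _ x
  exact congrArg (CohFamily.mk F₄ G₄ T p) (Subtype.ext (funext fun j => H j (x.1 j)))

end Functoriality

/-! ### The cohomology of an object of a site -/

section Site

variable {C : Type u} [Category.{v} C] {J : GrothendieckTopology C}

variable (J) in
/-- The covering families of `X`: those families that generate a covering sieve. The index sets are
large enough for the family of all the members of a sieve to be allowed. -/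
structure Cover (X : C) where
  /-- the family -/
  F : Family.{max u v} X
  /-- it generates a covering sieve -/
  cov : Sieve.ofArrows F.U F.f ∈ J X

/-- The pullback of a family along `h : X' ⟶ X`, without a choice of fibre products: it consists of
all the morphisms `g : Y ⟶ X'` that come with a morphism `l : Y ⟶ U i` such that `g ≫ h = l ≫ f i`. -/
@[simps] def Family.pullback {X' X : C} (h : X' ⟶ X) (F : Family.{max u v} X) :
    Family.{max u v} X' where
  I := Σ (Y : C) (i : F.I), { q : (Y ⟶ X') × (Y ⟶ F.U i) // q.1 ≫ h = q.2 ≫ F.f i }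
  U q := q.1
  f q := q.2.2.1.1

/-- The projection from the pullback of a family to the family. -/
@[simps] def Family.pullbackHom {X' X : C} (h : X' ⟶ X) (F : Family.{max u v} X) :
    (F.pullback h).Hom F h where
  idx q := q.2.1
  φ q := q.2.2.1.2
  comm q := q.2.2.2.symm

/-- A refinement induces a refinement of the pullbacks. -/
@[simps] def Family.Hom.pullback {X' X : C} (h : X' ⟶ X) {F' F : Family.{max u v} X}
    (φ : F'.Hom F (𝟙 X)) : (F'.pullback h).Hom (F.pullback h) (𝟙 X') where
  idx q := ⟨q.1, φ.idx q.2.1, ⟨(q.2.2.1.1, q.2.2.1.2 ≫ φ.φ q.2.1), by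
    have := φ.comm q.2.1
    rw [Category.comp_id] at this
    rw [Category.assoc, this, q.2.2.2]⟩⟩
  φ q := 𝟙 q.1
  comm q := (Category.id_comp _).trans (Category.comp_id _).symm

/-- The pullback of a covering family is a covering family. -/
@[simps] def Cover.pullback {X' X : C} (h : X' ⟶ X) (U : Cover J X) : Cover J X' where
  F := U.F.pullback h
  cov := by
    have e : Sieve.ofArrows (U.F.pullback h).U (U.F.pullback h).f =
        (Sieve.ofArrows U.F.U U.F.f).pullback h := by
      ext Y g
      rw [Sieve.pullback_apply, Sieve.mem_ofArrows_iff, Sieve.mem_ofArrows_iff]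
      constructor
      · rintro ⟨q, k, rfl⟩
        exact ⟨q.2.1, k ≫ q.2.2.1.2, (Category.assoc _ _ _).trans
          ((congrArg (k ≫ ·) q.2.2.2).trans (Category.assoc _ _ _).symm)⟩
      · rintro ⟨i, l, hl⟩
        exact ⟨⟨Y, i, ⟨(g, l), hl⟩⟩, 𝟙 Y, (Category.id_comp g).symm⟩
    rw [e]
    exact J.pullback_stable h U.cov

variable (J)

open Classical in
/-- The relations that define the direct limit over the covering families: a class on `U` is
identified with its image on `V` under every refinement `V → U`. -/
def limitRel (T : Totalization) (p : ZMod 2) (X : C) (G : Cᵒᵖ ⥤ ModuleCat.{w} ℂ) :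
    Submodule ℂ (DirectSum (Cover J X) fun U => CohFamily U.F G T p) :=
  Submodule.span ℂ {z | ∃ (U V : Cover J X) (φ : V.F.Hom U.F (𝟙 X)) (x : CohFamily U.F G T p),
    z = DirectSum.lof ℂ (Cover J X) (fun U => CohFamily U.F G T p) U x -
      DirectSum.lof ℂ (Cover J X) (fun U => CohFamily U.F G T p) V (cohFamilyMap φ (𝟙 G) T p x)}

/-- The `ℤ/2`-graded Čech cohomology of an object `X` of the site `(C, J)` with coefficients in a
presheaf `G` (in particular, in a sheaf): the direct limit, over the covering families of `X` and
their refinements, of the cohomologies of the total complexes. -/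
abbrev Coh (T : Totalization) (p : ZMod 2) (X : C) (G : Cᵒᵖ ⥤ ModuleCat.{w} ℂ) :
    Type (max w (u + 1) (v + 1)) :=
  (DirectSum (Cover J X) fun U => CohFamily U.F G T p) ⧸ limitRel J T p X G

open Classical in
/-- The canonical map from the cohomology of a covering family to the direct limit. -/
def toCoh (T : Totalization) (p : ZMod 2) {X : C} (G : Cᵒᵖ ⥤ ModuleCat.{w} ℂ) (U : Cover J X) :
    CohFamily U.F G T p →ₗ[ℂ] Coh J T p X G :=
  (limitRel J T p X G).mkQ ∘ₗ DirectSum.lof ℂ (Cover J X) (fun U => CohFamily U.F G T p) U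

lemma toCoh_refine (T : Totalization) (p : ZMod 2) {X : C} (G : Cᵒᵖ ⥤ ModuleCat.{w} ℂ)
    {U V : Cover J X} (φ : V.F.Hom U.F (𝟙 X)) (x : CohFamily U.F G T p) :
    toCoh J T p G V (cohFamilyMap φ (𝟙 G) T p x) = toCoh J T p G U x :=
  ((Submodule.Quotient.eq (limitRel J T p X G)).2
    (Submodule.subset_span (by exact ⟨U, V, φ, x, rfl⟩))).symm

open Classical in
/-- The universal property of the direct limit. -/
def cohLift (T : Totalization) (p : ZMod 2) {X : C} (G : Cᵒᵖ ⥤ ModuleCat.{w} ℂ)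
    {M : Type*} [AddCommGroup M] [Module ℂ M] (f : ∀ U : Cover J X, CohFamily U.F G T p →ₗ[ℂ] M)
    (hf : ∀ (U V : Cover J X) (φ : V.F.Hom U.F (𝟙 X)) (x : CohFamily U.F G T p),
      f V (cohFamilyMap φ (𝟙 G) T p x) = f U x) : Coh J T p X G →ₗ[ℂ] M :=
  (limitRel J T p X G).liftQ (DirectSum.toModule ℂ (Cover J X) M f) (by
    refine Submodule.span_le.2 ?_
    rintro _ ⟨U, V, φ, x, rfl⟩
    change DirectSum.toModule ℂ (Cover J X) M f _ = 0
    rw [map_sub, DirectSum.toModule_lof, DirectSum.toModule_lof, hf, sub_self])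

lemma cohLift_toCoh (T : Totalization) (p : ZMod 2) {X : C} (G : Cᵒᵖ ⥤ ModuleCat.{w} ℂ)
    {M : Type*} [AddCommGroup M] [Module ℂ M] (f : ∀ U : Cover J X, CohFamily U.F G T p →ₗ[ℂ] M)
    (hf : ∀ (U V : Cover J X) (φ : V.F.Hom U.F (𝟙 X)) (x : CohFamily U.F G T p),
      f V (cohFamilyMap φ (𝟙 G) T p x) = f U x) (U : Cover J X) (x : CohFamily U.F G T p) :
    cohLift J T p G f hf (toCoh J T p G U x) = f U x := by
  classical
  exact DirectSum.toModule_lof (M := fun U : Cover J X => CohFamily U.F G T p) ℂ U x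

/-- The identity of a family. -/
@[simps] def Family.Hom.id {X : C} (F : Family.{t} X) : F.Hom F (𝟙 X) where
  idx i := i
  φ i := 𝟙 (F.U i)
  comm _ := (Category.id_comp _).trans (Category.comp_id _).symm

/-- The map of Čech cohomologies induced by a morphism of coefficients. -/
def cohCoeff (T : Totalization) (p : ZMod 2) (X : C) {G G' : Cᵒᵖ ⥤ ModuleCat.{w} ℂ} (η : G ⟶ G') :
    Coh J T p X G →ₗ[ℂ] Coh J T p X G' :=
  cohLift J T p G (fun U => toCoh J T p G' U ∘ₗ cohFamilyMap (Family.Hom.id U.F) η T p)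
    (fun U V φ x => by
      refine Eq.trans ?_ (toCoh_refine J T p G' φ _)
      refine congrArg (toCoh J T p G' V) (cohFamilyMap_square φ (Family.Hom.id V.F)
        (Family.Hom.id U.F) φ (𝟙 G) η η (𝟙 G') (fun j c => ?_) T p x)
      ext i Y g
      change (η.app (op Y)).hom (c.1 (φ.idx ∘ i) Y ((g.push (Family.Hom.id V.F)).push φ)) =
        (η.app (op Y)).hom (c.1 (φ.idx ∘ i) Y ((g.push φ).push (Family.Hom.id U.F)))
      refine congrArg (fun z => (η.app (op Y)).hom (c.1 (φ.idx ∘ i) Y z))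
        (Pt.ext (funext fun s => ?_))
      have e₁ := Category.comp_id (g.g s)
      have e₂ := Category.comp_id (g.g s ≫ φ.φ (i s))
      exact (congrArg (· ≫ φ.φ (i s)) e₁).trans e₂.symm)

/-- The restriction map of Čech cohomologies along a morphism `h : X' ⟶ X`. -/
def cohRes (T : Totalization) (p : ZMod 2) {X' X : C} (h : X' ⟶ X) (G : Cᵒᵖ ⥤ ModuleCat.{w} ℂ) :
    Coh J T p X G →ₗ[ℂ] Coh J T p X' G :=
  cohLift J T p G
    (fun U => toCoh J T p G (U.pullback h) ∘ₗ cohFamilyMap (U.F.pullbackHom h) (𝟙 G) T p)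
    (fun U V φ x => by
      refine Eq.trans ?_ (toCoh_refine J T p G (U := U.pullback h) (V := V.pullback h)
        (φ.pullback h) _)
      refine congrArg (toCoh J T p G (V.pullback h)) (cohFamilyMap_square φ (V.F.pullbackHom h)
        (U.F.pullbackHom h) (φ.pullback h) (𝟙 G) (𝟙 G) (𝟙 G) (𝟙 G) (fun j c => ?_) T p x)
      ext i Y g
      change c.1 (φ.idx ∘ (V.F.pullbackHom h).idx ∘ i) Y ((g.push (V.F.pullbackHom h)).push φ) =
        c.1 (φ.idx ∘ (V.F.pullbackHom h).idx ∘ i) Y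
          ((g.push (φ.pullback h)).push (U.F.pullbackHom h))
      refine congrArg (fun z => c.1 (φ.idx ∘ (V.F.pullbackHom h).idx ∘ i) Y z)
        (Pt.ext (funext fun s => ?_))
      have e₁ := Category.comp_id (g.g s)
      have e₂ := Category.assoc (g.g s) (i s).2.2.1.2 (φ.φ (i s).2.1)
      exact e₂.trans (congrArg (· ≫ (i s).2.2.1.2 ≫ φ.φ (i s).2.1) e₁).symm)

end Site

/-! ### Isomorphisms of Čech cohomology theories -/

/-- An isomorphism between the `ℤ/2`-graded Čech cohomology theories of two categories: an
equivalence of categories, the bijection `topo` between the Grothendieck topologies that corresponds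
to it, and isomorphisms between the cohomologies of all corresponding objects with corresponding
coefficients, natural in both. -/
structure CohIso (C : Type u) [Category.{v} C] (D : Type u) [Category.{v} D] where
  /-- the equivalence of categories -/
  e : C ≌ D
  /-- the correspondence of the topologies -/
  topo : GrothendieckTopology C ≃ GrothendieckTopology D
  /-- a sieve on `e X` is covering if and only if its inverse image on `X` is -/
  mem_topo : ∀ (J : GrothendieckTopology C) (X : C) (S : Sieve (e.functor.obj X)),
    S ∈ topo J (e.functor.obj X) ↔ S.functorPullback e.functor ∈ J X
  /-- the canonical topologies correspond -/
  topo_canonical : topo (Sheaf.canonicalTopology C) = Sheaf.canonicalTopology D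
  /-- the sheaves correspond -/
  isSheaf_iff : ∀ (J : GrothendieckTopology C) (G : Dᵒᵖ ⥤ ModuleCat.{w} ℂ),
    Presheaf.IsSheaf (topo J) G ↔ Presheaf.IsSheaf J (e.functor.op ⋙ G)
  /-- the isomorphisms of the cohomologies -/
  iso : ∀ (J : GrothendieckTopology C) (T : Totalization) (p : ZMod 2) (X : C)
    (G : Dᵒᵖ ⥤ ModuleCat.{w} ℂ),
    Coh J T p X (e.functor.op ⋙ G) ≃ₗ[ℂ] Coh (topo J) T p (e.functor.obj X) G
  /-- naturality in the coefficients -/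
  iso_coeff : ∀ (J : GrothendieckTopology C) (T : Totalization) (p : ZMod 2) (X : C)
    (G G' : Dᵒᵖ ⥤ ModuleCat.{w} ℂ) (η : G ⟶ G') (x : Coh J T p X (e.functor.op ⋙ G)),
    iso J T p X G' (cohCoeff J T p X (Functor.whiskerLeft e.functor.op η) x) =
      cohCoeff (topo J) T p (e.functor.obj X) η (iso J T p X G x)
  /-- naturality in the object -/
  iso_res : ∀ (J : GrothendieckTopology C) (T : Totalization) (p : ZMod 2) (X' X : C) (h : X' ⟶ X)
    (G : Dᵒᵖ ⥤ ModuleCat.{w} ℂ) (x : Coh J T p X (e.functor.op ⋙ G)),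
    iso J T p X' G (cohRes J T p h (e.functor.op ⋙ G) x) =
      cohRes (topo J) T p (e.functor.map h) G (iso J T p X G x)

/-! ### The category of `*`-representations -/

/-- A non-degenerate `*`-representation of a complex `*`-algebra `B` (which need not have a unit) on
a Hilbert space. -/
structure StarRep (B : Type u) [NonUnitalRing B] [StarRing B] [Module ℂ B] where
  /-- the Hilbert space -/
  H : Type v
  [normedAddCommGroup : NormedAddCommGroup H]
  [innerProductSpace : InnerProductSpace ℂ H]
  [completeSpace : CompleteSpace H]
  /-- the action -/
  π : B →⋆ₙₐ[ℂ] (H →L[ℂ] H)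
  /-- non-degeneracy -/
  dense : Dense (Submodule.span ℂ {x : H | ∃ (a : B) (h : H), x = π a h} : Set H)

attribute [instance] StarRep.normedAddCommGroup StarRep.innerProductSpace StarRep.completeSpace

/-- Morphisms of `*`-representations are the bounded intertwining operators. -/
@[ext] structure StarRep.Hom {B : Type u} [NonUnitalRing B] [StarRing B] [Module ℂ B]
    (V W : StarRep.{v} B) where
  /-- the operator -/
  T : V.H →L[ℂ] W.H
  /-- the intertwining property -/
  comm : ∀ (a : B) (h : V.H), T (V.π a h) = W.π a (T h)

instance (B : Type u) [NonUnitalRing B] [StarRing B] [Module ℂ B] :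
    Category (StarRep.{v} B) where
  Hom V W := StarRep.Hom V W
  id V := ⟨ContinuousLinearMap.id ℂ V.H, fun _ _ => rfl⟩
  comp f g := ⟨g.T.comp f.T, fun a h => by
    rw [ContinuousLinearMap.comp_apply, f.comm, g.comm, ContinuousLinearMap.comp_apply]⟩

/-- `A ⊗ Mat_n(ℂ)` is a `*`-algebra with `(a ⊗ x)^* = a^* ⊗ x^*`. -/
instance tensorMatrixStarRing (A : Type u) [NonUnitalCStarAlgebra A] (n : ℕ) :
    StarRing (A ⊗[ℂ] Matrix (Fin n) (Fin n) ℂ) where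
  star_mul x y := by
    induction x using TensorProduct.induction_on with
    | zero => simp
    | add x x' hx hx' => rw [add_mul, star_add, hx, hx', star_add, mul_add]
    | tmul a m =>
      induction y using TensorProduct.induction_on with
      | zero => simp
      | add y y' hy hy' => rw [mul_add, star_add, hy, hy', star_add, add_mul]
      | tmul a' m' =>
        simp only [TensorProduct.star_tmul, Algebra.TensorProduct.tmul_mul_tmul, star_mul]
  star_add := star_add

end CechZ2

end

/-!
The theorem splits into a formal part and two Morita equivalences.

Formal part: everything in the definition of the `ℤ/2`-graded Čech cohomology is invariant under
an equivalence of categories `e : C ≌ D` (`CohIso.ofEquivalence`). Grothendieck topologies are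
transported as induced topologies (`topoEquiv`), and the canonical topologies correspond because
the representable presheaves do. A family over `X` has an image over `e X`, and a cochain of the
image restricts to a cochain of the family by evaluating it at images of points (`restr`). As `e`
is fully faithful and essentially surjective, this is bijective (`restr_bijective`). It commutes
with all maps that reindex positions, hence with the total differentials, so the cohomologies of
the family and of its image agree (`cohRestr`). Images of covering families of `X` are cofinal
among the covering families of `e X`: such a family `V` is refined by the image of the family of
preimages of its members. This gives mutually inverse maps of the direct limits (`cohMap`,
`cohComap`).

Modules: `ModuleCat A` is equivalent to the modules over `Mat_n(A) ≅ A ⊗ Mat_n(ℂ)`.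

Representations: the equivalence is `H ↦ H ⊗ ℂ^n = H^n` (`amplifyFunctor`). It is full because an
operator `H^n → K^n` that intertwines all `a ⊗ E_{ij}` is diagonal with equal diagonal entries. It
is essentially surjective because, on a representation of `A ⊗ Mat_n(ℂ)` on `W`, the matrix units
`1 ⊗ E_{ij}` act although `A` need not have a unit (`matUnit`): the assignment
`π(a ⊗ m) k ↦ π(a ⊗ E_{ij} m) k` is contractive on a dense subspace, because inner products of
vectors `∑ π(a ⊗ x m) k` and `∑ π(a ⊗ y m) k` depend on `x` and `y` through `x^* y` only. The range
of `1 ⊗ E_{ii}` carries a representation of `A` (`cornerRep`) whose amplification is isomorphic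
to `W`.
-/

universe w v u

noncomputable section

namespace CechZ2

universe t

/-! ### Transport of Grothendieck topologies along an equivalence -/

section Topology

variable {C : Type u} [Category.{v} C] {D : Type u} [Category.{v} D]

lemma inducedTopology_inducedTopology (e : C ≌ D) (J : GrothendieckTopology C) :
    e.functor.inducedTopology (e.inverse.inducedTopology J) = J := by
  ext
  simp [Functor.mem_inducedTopology_iff_of_isCoverDense,
    Sieve.functorPushforward_equivalence_eq_pullback]

/-- The bijection between the Grothendieck topologies on two equivalent categories. In both
directions it is Mathlib's induced topology, along the functor that goes the opposite way. -/
def topoEquiv (e : C ≌ D) : GrothendieckTopology C ≃ GrothendieckTopology D where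
  toFun J := e.inverse.inducedTopology J
  invFun K := e.functor.inducedTopology K
  left_inv J := inducedTopology_inducedTopology e J
  right_inv K := inducedTopology_inducedTopology e.symm K

lemma topoEquiv_mono (e : C ≌ D) : Monotone (topoEquiv e) := by
  intro J J' h Y S hS
  have hS : S ∈ e.inverse.inducedTopology J Y := hS
  change S ∈ e.inverse.inducedTopology J' Y
  rw [Functor.mem_inducedTopology_iff_of_isCoverDense] at hS ⊢
  exact h _ hS

instance (e : C ≌ D) (J : GrothendieckTopology C) : e.functor.IsDenseSubsite J (topoEquiv e J) :=
  inferInstanceAs (e.functor.IsDenseSubsite J (e.inverse.inducedTopology J))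

instance (e : C ≌ D) (J : GrothendieckTopology C) : e.inverse.IsContinuous (topoEquiv e J) J :=
  inferInstanceAs (e.inverse.IsContinuous (e.inverse.inducedTopology J) J)

lemma mem_topoEquiv (e : C ≌ D) (J : GrothendieckTopology C) (X : C)
    (S : Sieve (e.functor.obj X)) :
    S ∈ topoEquiv e J (e.functor.obj X) ↔ S.functorPullback e.functor ∈ J X := by
  rw [← e.functor.functorPushforward_mem_iff J (topoEquiv e J)]
  have : (S.functorPullback e.functor).functorPushforward e.functor = S := by
    refine le_antisymm (Sieve.functorPullback_pushforward_le _ _) fun Y f hf => ?_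
    refine ⟨e.functor.objPreimage Y, e.functor.preimage ((e.functor.objObjPreimageIso Y).hom ≫ f),
      (e.functor.objObjPreimageIso Y).inv, ?_, by simp⟩
    simpa using! S.downward_closed hf (e.functor.objObjPreimageIso Y).hom
  rw [this]

lemma topoEquiv_isSheaf_iff (e : C ≌ D) (J : GrothendieckTopology C) {A : Type*} [Category A]
    (G : Dᵒᵖ ⥤ A) :
    Presheaf.IsSheaf (topoEquiv e J) G ↔ Presheaf.IsSheaf J (e.functor.op ⋙ G) := by
  refine ⟨e.functor.op_comp_isSheaf_of_isSheaf J _ G, fun h => ?_⟩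
  have h' := e.inverse.op_comp_isSheaf_of_isSheaf (topoEquiv e J) J _ h
  refine (Presheaf.isSheaf_of_iso_iff ?_).1 h'
  exact Functor.isoWhiskerRight e.op.counitIso G

/-- The transported topology is subcanonical. Applied to `e.symm` as well, this identifies the two
canonical topologies. -/
lemma topoEquiv_canonical_le (e : C ≌ D) :
    topoEquiv e (Sheaf.canonicalTopology C) ≤ Sheaf.canonicalTopology D := by
  refine Sheaf.le_finestTopology _ _ ?_
  rintro _ ⟨Y, rfl⟩
  rw [← isSheaf_iff_isSheaf_of_type, topoEquiv_isSheaf_iff, isSheaf_iff_isSheaf_of_type]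
  -- the presheaf `Hom (e -, Y)` on `C` is represented by `e.inverse Y`
  have := (e.toAdjunction.representableBy Y).isRepresentable
  exact Sheaf.isSheaf_of_isRepresentable _

lemma topoEquiv_canonical (e : C ≌ D) :
    topoEquiv e (Sheaf.canonicalTopology C) = Sheaf.canonicalTopology D := by
  refine le_antisymm (topoEquiv_canonical_le e) ?_
  have h := topoEquiv_mono e (topoEquiv_canonical_le e.symm)
  rwa [show topoEquiv e.symm = (topoEquiv e).symm from rfl, Equiv.apply_symm_apply] at h

end Topology

/-! ### Transport of Čech cochains along a functor -/

section Transport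

variable {C : Type u} [Category.{v} C] {D : Type u} [Category.{v} D] (E : C ⥤ D)

/-- The image of a family of morphisms under a functor. -/
abbrev Family.map {X : C} (F : Family.{t} X) : Family.{t} (E.obj X) where
  I := F.I
  U i := E.obj (F.U i)
  f i := E.map (F.f i)

variable {X : C} {F : Family.{t} X}

/-- The image of a point of a fibre product under a functor. -/
@[simps] def Pt.map {k : ℕ} {i : Fin (k + 1) → F.I} {Y : C} (g : Pt F i Y) :
    Pt (F.map E) i (E.obj Y) where
  g s := E.map (g.g s)
  w r s := by
    change E.map _ ≫ E.map (F.f _) = E.map _ ≫ E.map (F.f _)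
    rw [← E.map_comp, g.w r s, E.map_comp]

lemma Pt.map_comp {k : ℕ} {i : Fin (k + 1) → F.I} {Y Y' : C} (g : Pt F i Y) (h : Y' ⟶ Y) :
    (g.comp h).map E = (g.map E).comp (E.map h) :=
  Pt.ext (funext fun s => E.map_comp h (g.g s))

/-- Cochains of the image of a family restrict to cochains of the family, with coefficients in the
composed presheaf. -/
def restr (F : Family.{t} X) (G : Dᵒᵖ ⥤ ModuleCat.{w} ℂ) (k : ℕ) :
    Cochain (F.map E) G k →ₗ[ℂ] Cochain F (E.op ⋙ G) k where
  toFun c := ⟨fun i Y g => c.1 i (E.obj Y) (g.map E), fun i Y Y' h g => by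
    change _ = c.1 i (E.obj Y') ((g.comp h).map E)
    rw [Pt.map_comp, ← c.2]
    rfl⟩
  map_add' _ _ := rfl
  map_smul' _ _ := rfl

lemma restr_reindex (G : Dᵒᵖ ⥤ ModuleCat.{w} ℂ) {k m : ℕ} (α : Fin (k + 1) → Fin (m + 1))
    (c : Cochain (F.map E) G k) : restr E F G m (reindex α c) = reindex α (restr E F G k c) := rfl

lemma restr_lam (G : Dᵒᵖ ⥤ ModuleCat.{w} ℂ) (k : ℕ) (c : Cochain (F.map E) G k) :
    restr E F G k (lam _ _ k c) = lam _ _ k (restr E F G k c) := by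
  simp [lam, restr_reindex]

lemma restr_lam_pow (G : Dᵒᵖ ⥤ ModuleCat.{w} ℂ) (k n : ℕ) (c : Cochain (F.map E) G k) :
    restr E F G k ((lam _ _ k ^ n) c) = (lam _ _ k ^ n) (restr E F G k c) := by
  induction n with
  | zero => rfl
  | succ n ih => rw [pow_succ', pow_succ', Module.End.mul_apply, Module.End.mul_apply,
      restr_lam, ih]

lemma restr_hor (G : Dᵒᵖ ⥤ ModuleCat.{w} ℂ) (q : ZMod 2) (k : ℕ) (c : Cochain (F.map E) G k) :
    restr E F G k (hor _ _ q k c) = hor _ _ q k (restr E F G k c) := by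
  unfold hor
  split_ifs
  · simp [restr_lam]
  · simp [norm, restr_lam_pow]

lemma restr_ver (G : Dᵒᵖ ⥤ ModuleCat.{w} ℂ) (q : ZMod 2) (k : ℕ) (c : Cochain (F.map E) G k) :
    restr E F G (k + 1) (ver _ _ q k c) = ver _ _ q k (restr E F G k c) := by
  unfold ver
  split_ifs
  · simp [b, restr_reindex]
  · simp [b', restr_reindex]

/-- A `Y`-point of the fibre product of the image family is, up to the isomorphism of `Y` with the
image of its preimage object `Z`, the image of a `Z`-point. -/
def Pt.preimage [E.IsEquivalence] {k : ℕ} {i : Fin (k + 1) → F.I} {Y : D} (g : Pt (F.map E) i Y) :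
    Pt F i (E.objPreimage Y) where
  g s := E.preimage ((E.objObjPreimageIso Y).hom ≫ g.g s)
  w r s := E.map_injective (by
    rw [E.map_comp, E.map_comp, E.map_preimage, E.map_preimage, Category.assoc, Category.assoc]
    exact congrArg _ (g.w r s))

lemma Pt.map_preimage [E.IsEquivalence] {k : ℕ} {i : Fin (k + 1) → F.I} {Y : D}
    (g : Pt (F.map E) i Y) : (g.preimage E).map E = g.comp (E.objObjPreimageIso Y).hom :=
  Pt.ext (funext fun _ => E.map_preimage _)

lemma Pt.map_injective [E.IsEquivalence] {k : ℕ} {i : Fin (k + 1) → F.I} {Y : C} :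
    Function.Injective (Pt.map E : Pt F i Y → Pt (F.map E) i (E.obj Y)) := fun _ _ h =>
  Pt.ext (funext fun s => E.map_injective (congrArg (fun x => x.g s) h))

lemma Pt.comp_comp {k : ℕ} {i : Fin (k + 1) → F.I} {Y Y' Y'' : C} (g : Pt F i Y) (h : Y' ⟶ Y)
    (h' : Y'' ⟶ Y') : (g.comp h).comp h' = g.comp (h' ≫ h) :=
  Pt.ext (funext fun s => (Category.assoc h' h (g.g s)).symm)

/-- Points over the objects of the form `E Y` determine a cochain, because `E` is essentially
surjective, and they are the images of points over `Y`, because `E` is fully faithful. -/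
lemma restr_bijective [E.IsEquivalence] (G : Dᵒᵖ ⥤ ModuleCat.{w} ℂ) (k : ℕ) :
    Function.Bijective (restr E F G k) := by
  constructor
  · intro c c' h
    ext i Y g
    have h' : c.1 i _ ((g.preimage E).map E) = c'.1 i _ ((g.preimage E).map E) :=
      congrArg (fun x : Cochain F (E.op ⋙ G) k => x.1 i _ (g.preimage E)) h
    rw [Pt.map_preimage, ← c.2, ← c'.2] at h'
    have hinj : Function.Injective (G.map (E.objObjPreimageIso Y).hom.op).hom :=
      (ConcreteCategory.bijective_of_isIso (G.map (E.objObjPreimageIso Y).hom.op)).1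
    exact hinj h'
  · intro c
    refine ⟨⟨fun i Y g => (G.map (E.objObjPreimageIso Y).inv.op).hom (c.1 i _ (g.preimage E)),
      fun i Y Y' h g => ?_⟩, ?_⟩
    · let h' : E.objPreimage Y' ⟶ E.objPreimage Y :=
        E.preimage ((E.objObjPreimageIso Y').hom ≫ h ≫ (E.objObjPreimageIso Y).inv)
      have e : (g.comp h).preimage E = (g.preimage E).comp h' := by
        apply Pt.map_injective E
        rw [Pt.map_preimage, Pt.map_comp, Pt.map_preimage, Pt.comp_comp, Pt.comp_comp]
        simp [h']
      change _ = (G.map _).hom (c.1 i _ ((g.comp h).preimage E))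
      rw [e, ← c.2]
      change (G.map (E.objObjPreimageIso Y).inv.op ≫ G.map h.op).hom _ =
        (G.map (E.map h').op ≫ G.map (E.objObjPreimageIso Y').inv.op).hom _
      have e' : (E.objObjPreimageIso Y').inv ≫ E.map h' = h ≫ (E.objObjPreimageIso Y).inv := by
        simp [h']
      rw [← G.map_comp, ← G.map_comp, ← op_comp, ← op_comp, e']
      rfl
    · ext i Y g
      let h' : E.objPreimage (E.obj Y) ⟶ Y := E.preimage (E.objObjPreimageIso (E.obj Y)).hom
      have e : (g.map E).preimage E = g.comp h' := by
        apply Pt.map_injective E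
        rw [Pt.map_preimage, Pt.map_comp]
        simp [h']
      change (G.map _).hom (c.1 i _ ((g.map E).preimage E)) = _
      rw [e, ← c.2]
      change (G.map (E.map h').op ≫ G.map (E.objObjPreimageIso (E.obj Y)).inv.op).hom _ = _
      rw [← G.map_comp, ← op_comp]
      simp [h']

/-- The restriction maps as a map of the entries of the total complexes. -/
def totRestr (F : Family.{t} X) (G : Dᵒᵖ ⥤ ModuleCat.{w} ℂ) :
    (∀ j, Cochain (F.map E) G j) →ₗ[ℂ] (∀ j, Cochain F (E.op ⋙ G) j) :=
  LinearMap.pi fun j => restr E F G j ∘ₗ LinearMap.proj j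

lemma totRestr_totD (G : Dᵒᵖ ⥤ ModuleCat.{w} ℂ) (p : ZMod 2) (x : ∀ j, Cochain (F.map E) G j) :
    totRestr E F G (totD _ _ p x) = totD _ _ p (totRestr E F G x) := by
  funext j
  cases j with
  | zero => simp [totRestr, totD, restr_hor]
  | succ j => simp [totRestr, totD, restr_hor, restr_ver]

lemma totRestr_bijective [E.IsEquivalence] (G : Dᵒᵖ ⥤ ModuleCat.{w} ℂ) :
    Function.Bijective (totRestr E F G) := by
  constructor
  · intro x y h
    exact funext fun j => (restr_bijective E G j).1 (congrFun h j)
  · intro y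
    choose x hx using fun j => (restr_bijective E (F := F) G j).2 (y j)
    exact ⟨x, funext hx⟩

lemma totRestr_mem_iff [E.IsEquivalence] (G : Dᵒᵖ ⥤ ModuleCat.{w} ℂ) (T : Totalization)
    (x : ∀ j, Cochain (F.map E) G j) : totRestr E F G x ∈ Tot F (E.op ⋙ G) T ↔ x ∈ Tot _ G T := by
  cases T with
  | prod => exact Iff.rfl
  | sum =>
    have h : ∀ j, restr E F G j (x j) = 0 ↔ x j = 0 :=
      fun j => map_eq_zero_iff _ (restr_bijective E G j).1
    exact exists_congr fun m => forall_congr' fun j => imp_congr_right fun _ => h j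

/-- The isomorphism of the cohomologies of the image of a family and of the family. -/
def cohRestr [E.IsEquivalence] (F : Family.{t} X) (G : Dᵒᵖ ⥤ ModuleCat.{w} ℂ) (T : Totalization)
    (p : ZMod 2) : CohFamily (F.map E) G T p ≃ₗ[ℂ] CohFamily F (E.op ⋙ G) T p :=
  LinearEquiv.ofBijective
    (Submodule.mapQ ((boundaries (F.map E) G T p).submoduleOf (cycles (F.map E) G T p))
      ((boundaries F (E.op ⋙ G) T p).submoduleOf (cycles F (E.op ⋙ G) T p))
      ((totRestr E F G).restrict fun x hx => ⟨(totRestr_mem_iff E G T x).2 hx.1, by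
        change totD _ _ p (totRestr E F G x) = 0
        rw [← totRestr_totD, LinearMap.mem_ker.1 hx.2, map_zero]⟩)
      (by
        rintro ⟨x, hx⟩ ⟨y, hy, hyx⟩
        refine ⟨totRestr E F G y, (totRestr_mem_iff E G T y).2 hy, ?_⟩
        rw [← totRestr_totD, hyx]
        rfl)) (by
    constructor
    · rw [injective_iff_map_eq_zero]
      intro x
      obtain ⟨⟨x, hx⟩, rfl⟩ := Submodule.Quotient.mk_surjective _ x
      intro h
      obtain ⟨y, hy, hyx⟩ := (Submodule.Quotient.mk_eq_zero _).1 h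
      obtain ⟨y, rfl⟩ := (totRestr_bijective E G).2 y
      refine (Submodule.Quotient.mk_eq_zero _).2 ⟨y, (totRestr_mem_iff E G T y).1 hy, ?_⟩
      rw [← totRestr_totD] at hyx
      exact (totRestr_bijective E G).1 hyx
    · intro x
      obtain ⟨⟨x, hx⟩, rfl⟩ := Submodule.Quotient.mk_surjective _ x
      obtain ⟨x, rfl⟩ := (totRestr_bijective E G).2 x
      refine ⟨Submodule.Quotient.mk ⟨x, (totRestr_mem_iff E G T x).1 hx.1, ?_⟩, rfl⟩
      refine LinearMap.mem_ker.2 ((totRestr_bijective E G).1 ?_)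
      rw [totRestr_totD, map_zero]
      exact hx.2)

/-- A commutative square of cochain maps and restriction maps induces one of cohomologies. The
morphism `φ'` stands for the image of `φ`; it is only assumed to induce the right map of cochains,
so that it may lie over a morphism `h'` that is not definitionally `E.map h`, such as `𝟙` when
`h = 𝟙`. -/
lemma cohRestr_cohFamilyMap [E.IsEquivalence] {X' : C} {F : Family.{t} X} {F' : Family.{t} X'}
    {h : X' ⟶ X} {h' : E.obj X' ⟶ E.obj X} {G G' : Dᵒᵖ ⥤ ModuleCat.{w} ℂ}
    (φ : F'.Hom F h) (φ' : (F'.map E).Hom (F.map E) h') (η : G ⟶ G')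
    (η' : E.op ⋙ G ⟶ E.op ⋙ G')
    (H : ∀ j (c : Cochain (F.map E) G j),
      restr E F' G' j (cochainMap φ' η j c) = cochainMap φ η' j (restr E F G j c))
    (T : Totalization) (p : ZMod 2) (x : CohFamily (F.map E) G T p) :
    cohRestr E F' G' T p (cohFamilyMap φ' η T p x) =
      cohFamilyMap φ η' T p (cohRestr E F G T p x) := by
  obtain ⟨x, rfl⟩ := Submodule.Quotient.mk_surjective _ x
  exact congrArg (CohFamily.mk F' (E.op ⋙ G') T p) (Subtype.ext (funext fun j => H j (x.1 j)))

end Transport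

/-! ### Invariance of Čech cohomology under equivalences of categories -/

section Invariance

lemma Coh.hom_ext {C : Type u} [Category.{v} C] {J : GrothendieckTopology C} {T : Totalization}
    {p : ZMod 2} {X : C} {G : Cᵒᵖ ⥤ ModuleCat.{w} ℂ} {M : Type*} [AddCommGroup M] [Module ℂ M]
    {f g : Coh J T p X G →ₗ[ℂ] M}
    (h : ∀ (U : Cover J X) (x : CohFamily U.F G T p),
      f (toCoh J T p G U x) = g (toCoh J T p G U x)) : f = g := by
  classical
  exact Submodule.linearMap_qext _ (DirectSum.linearMap_ext ℂ fun U => LinearMap.ext (h U))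

lemma cohFamilyMap_triangle {C : Type u} [Category.{v} C] {X₁ X₂ X₃ : C} {F₁ : Family.{t} X₁}
    {F₂ : Family.{t} X₂} {F₃ : Family.{t} X₃} {h₁ : X₂ ⟶ X₁} {h₂ : X₃ ⟶ X₂} {h₃ : X₃ ⟶ X₁}
    {G₁ G₂ G₃ : Cᵒᵖ ⥤ ModuleCat.{w} ℂ} (φ₁ : F₂.Hom F₁ h₁) (φ₂ : F₃.Hom F₂ h₂) (φ₃ : F₃.Hom F₁ h₃)
    (η₁ : G₁ ⟶ G₂) (η₂ : G₂ ⟶ G₃) (η₃ : G₁ ⟶ G₃)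
    (H : ∀ j (c : Cochain F₁ G₁ j),
      cochainMap φ₂ η₂ j (cochainMap φ₁ η₁ j c) = cochainMap φ₃ η₃ j c)
    (T : Totalization) (p : ZMod 2) (x : CohFamily F₁ G₁ T p) :
    cohFamilyMap φ₂ η₂ T p (cohFamilyMap φ₁ η₁ T p x) = cohFamilyMap φ₃ η₃ T p x := by
  obtain ⟨x, rfl⟩ := Submodule.Quotient.mk_surjective _ x
  exact congrArg (CohFamily.mk F₃ G₃ T p) (Subtype.ext (funext fun j => H j (x.1 j)))

variable {C : Type u} [Category.{v} C] {D : Type u} [Category.{v} D] (e : C ≌ D)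
  (J : GrothendieckTopology C)

/-- The image of a covering family under an equivalence. -/
@[simps] def Cover.map {J : GrothendieckTopology C} {X : C} (U : Cover J X) :
    Cover (topoEquiv e J) (e.functor.obj X) where
  F := U.F.map e.functor
  cov := by
    rw [mem_topoEquiv]
    refine J.superset_covering ?_ U.cov
    rintro Y f hf
    obtain ⟨i, a, rfl⟩ := (Sieve.mem_ofArrows_iff _ _ _).1 hf
    exact (Sieve.mem_ofArrows_iff _ _ _).2 ⟨i, e.functor.map a, e.functor.map_comp _ _⟩

/-- The family over `X` that consists of preimages of the members of a family over `e X`. -/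
abbrev Family.preimage {X : C} (F : Family.{t} (e.functor.obj X)) : Family.{t} X where
  I := F.I
  U i := e.functor.objPreimage (F.U i)
  f i := e.functor.preimage ((e.functor.objObjPreimageIso (F.U i)).hom ≫ F.f i)

/-- The image of the preimage of a family refines the family. -/
def Family.preimageHom {X : C} (F : Family.{t} (e.functor.obj X)) :
    ((F.preimage e).map e.functor).Hom F (𝟙 _) where
  idx i := i
  φ i := (e.functor.objObjPreimageIso (F.U i)).hom
  comm i := by
    change _ = e.functor.map (e.functor.preimage _) ≫ 𝟙 _
    rw [e.functor.map_preimage, Category.comp_id]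

/-- A refinement of families over `e X` induces a refinement of their preimages. -/
def Family.Hom.preimage {X : C} {F F' : Family.{t} (e.functor.obj X)} (φ : F'.Hom F (𝟙 _)) :
    (F'.preimage e).Hom (F.preimage e) (𝟙 _) where
  idx := φ.idx
  φ j := e.functor.preimage ((e.functor.objObjPreimageIso (F'.U j)).hom ≫ φ.φ j ≫
    (e.functor.objObjPreimageIso (F.U (φ.idx j))).inv)
  comm j := e.functor.map_injective (by
    have := φ.comm j
    rw [Category.comp_id] at this
    simp [this])

/-- The preimage of a covering family. -/
@[simps] def Cover.preimage {J : GrothendieckTopology C} {X : C}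
    (V : Cover (topoEquiv e J) (e.functor.obj X)) : Cover J X where
  F := V.F.preimage e
  cov := by
    refine J.superset_covering ?_ ((mem_topoEquiv e J X _).1 V.cov)
    rintro Y f hf
    obtain ⟨i, a, ha⟩ := (Sieve.mem_ofArrows_iff _ _ _).1 hf
    refine (Sieve.mem_ofArrows_iff _ _ _).2
      ⟨i, e.functor.preimage (a ≫ (e.functor.objObjPreimageIso (V.F.U i)).inv), ?_⟩
    exact e.functor.map_injective (by simpa using ha)

/-- The map of cohomologies from `C` to `D`: on a covering family of `X`, it is the inverse of the
restriction isomorphism of the image family. -/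
def cohMap (T : Totalization) (p : ZMod 2) (X : C) (G : Dᵒᵖ ⥤ ModuleCat.{w} ℂ) :
    Coh J T p X (e.functor.op ⋙ G) →ₗ[ℂ] Coh (topoEquiv e J) T p (e.functor.obj X) G :=
  cohLift J T p (e.functor.op ⋙ G)
    (fun U => toCoh (topoEquiv e J) T p G (U.map e) ∘ₗ
      (cohRestr e.functor U.F G T p).symm.toLinearMap)
    (fun U V φ x => by
      let φ' : (V.map e).F.Hom (U.map e).F (𝟙 _) :=
        { idx := φ.idx
          φ := fun j => e.functor.map (φ.φ j)
          comm := fun j => by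
            have := congrArg e.functor.map (φ.comm j)
            rw [Category.comp_id, e.functor.map_comp] at this
            rw [Category.comp_id]
            exact this }
      refine Eq.trans ?_ (toCoh_refine (topoEquiv e J) T p G φ' _)
      refine congrArg (toCoh (topoEquiv e J) T p G (V.map e)) ?_
      refine (LinearEquiv.symm_apply_eq _).2 ?_
      obtain ⟨x, rfl⟩ := (cohRestr e.functor U.F G T p).surjective x
      refine Eq.trans ?_
        (cohRestr_cohFamilyMap e.functor φ φ' (𝟙 G) (𝟙 _) (fun j c => ?_) T p _).symm
      · exact congrArg (fun z => cohFamilyMap φ _ T p (cohRestr e.functor U.F G T p z))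
          (LinearEquiv.symm_apply_apply _ x).symm
      · ext i Y g
        refine congrArg (c.1 (φ.idx ∘ i) (e.functor.obj Y)) (Pt.ext (funext fun s => ?_))
        exact (e.functor.map_comp _ _).symm)

lemma cohMap_toCoh (T : Totalization) (p : ZMod 2) {X : C} (G : Dᵒᵖ ⥤ ModuleCat.{w} ℂ)
    (U : Cover J X) (x : CohFamily (U.F.map e.functor) G T p) :
    cohMap e J T p X G (toCoh J T p _ U (cohRestr e.functor U.F G T p x)) =
      toCoh (topoEquiv e J) T p G (U.map e) x := by
  refine (cohLift_toCoh J T p _ _ _ U _).trans ?_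
  exact congrArg (toCoh (topoEquiv e J) T p G (U.map e)) (LinearEquiv.symm_apply_apply _ x)

/-- The map of cohomologies from `D` to `C`: on a covering family of `e X`, it is the refinement by
the image of the preimage family, followed by restriction. -/
def cohComap (T : Totalization) (p : ZMod 2) (X : C) (G : Dᵒᵖ ⥤ ModuleCat.{w} ℂ) :
    Coh (topoEquiv e J) T p (e.functor.obj X) G →ₗ[ℂ] Coh J T p X (e.functor.op ⋙ G) :=
  cohLift (topoEquiv e J) T p G
    (fun V => toCoh J T p (e.functor.op ⋙ G) (V.preimage e) ∘ₗ
      (cohRestr e.functor (V.F.preimage e) G T p).toLinearMap ∘ₗ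
        cohFamilyMap (V.F.preimageHom e) (𝟙 G) T p)
    (fun U V φ x => by
      let φ' : ((V.F.preimage e).map e.functor).Hom ((U.F.preimage e).map e.functor) (𝟙 _) :=
        { idx := φ.idx
          φ := fun j => (e.functor.objObjPreimageIso (V.F.U j)).hom ≫ φ.φ j ≫
            (e.functor.objObjPreimageIso (U.F.U (φ.idx j))).inv
          comm := fun j => by
            have := φ.comm j
            rw [Category.comp_id] at this
            simp [this] }
      refine Eq.trans ?_
        (toCoh_refine J T p (e.functor.op ⋙ G) (U := U.preimage e) (V := V.preimage e)
          (φ.preimage e) _)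
      refine congrArg (toCoh J T p (e.functor.op ⋙ G) (V.preimage e)) ?_
      refine Eq.trans ?_ (cohRestr_cohFamilyMap e.functor (φ.preimage e) φ' (𝟙 G) (𝟙 _)
        (fun j c => ?_) T p _)
      · refine congrArg (cohRestr e.functor (V.F.preimage e) G T p) ?_
        refine cohFamilyMap_square φ (V.F.preimageHom e) (U.F.preimageHom e) φ' (𝟙 G) (𝟙 G) (𝟙 G)
          (𝟙 G) (fun j c => ?_) T p x
        ext i Y g
        refine congrArg (c.1 (φ.idx ∘ i) Y) (Pt.ext (funext fun s => ?_))
        change (g.g s ≫ (e.functor.objObjPreimageIso _).hom) ≫ φ.φ (i s) =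
          (g.g s ≫ (e.functor.objObjPreimageIso _).hom ≫ φ.φ (i s) ≫
            (e.functor.objObjPreimageIso _).inv) ≫ (e.functor.objObjPreimageIso _).hom
        simp
      · ext i Y g
        refine congrArg (c.1 (φ.idx ∘ i) (e.functor.obj Y)) (Pt.ext (funext fun s => ?_))
        change e.functor.map (g.g s) ≫ _ = e.functor.map (g.g s ≫ e.functor.preimage _)
        rw [e.functor.map_comp, e.functor.map_preimage])

lemma cohComap_toCoh (T : Totalization) (p : ZMod 2) {X : C} (G : Dᵒᵖ ⥤ ModuleCat.{w} ℂ)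
    (V : Cover (topoEquiv e J) (e.functor.obj X)) (x : CohFamily V.F G T p) :
    cohComap e J T p X G (toCoh (topoEquiv e J) T p G V x) =
      toCoh J T p _ (V.preimage e) (cohRestr e.functor (V.F.preimage e) G T p
        (cohFamilyMap (V.F.preimageHom e) (𝟙 G) T p x)) :=
  cohLift_toCoh (topoEquiv e J) T p _ _ _ V _

/-- The isomorphism of the cohomologies of corresponding objects of equivalent sites. -/
def cohEquiv (T : Totalization) (p : ZMod 2) (X : C) (G : Dᵒᵖ ⥤ ModuleCat.{w} ℂ) :
    Coh J T p X (e.functor.op ⋙ G) ≃ₗ[ℂ] Coh (topoEquiv e J) T p (e.functor.obj X) G :=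
  LinearEquiv.ofLinearMap (cohMap e J T p X G) (cohComap e J T p X G)
    (by
      refine Coh.hom_ext fun V x => ?_
      rw [LinearMap.comp_apply, cohComap_toCoh]
      refine (cohMap_toCoh e J T p G (V.preimage e) _).trans ?_
      exact toCoh_refine (topoEquiv e J) T p G (V := (V.preimage e).map e) (V.F.preimageHom e) x)
    (by
      refine Coh.hom_ext fun U x => ?_
      obtain ⟨x, rfl⟩ := (cohRestr e.functor U.F G T p).surjective x
      rw [LinearMap.comp_apply, cohMap_toCoh]
      refine (cohComap_toCoh e J T p G (U.map e) x).trans ?_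
      -- the preimage of the image of `U` refines `U`
      let ψ : ((U.F.map e.functor).preimage e).Hom U.F (𝟙 X) :=
        { idx := fun i => i
          φ := fun i => e.functor.preimage
            (e.functor.objObjPreimageIso (e.functor.obj (U.F.U i))).hom
          comm := fun i => e.functor.map_injective (by simp) }
      refine Eq.trans ?_ (toCoh_refine J T p _ (V := (U.map e).preimage e) ψ _)
      refine congrArg (toCoh J T p _ ((U.map e).preimage e)) ?_
      refine cohRestr_cohFamilyMap e.functor ψ _ (𝟙 G) (𝟙 _) (fun j c => ?_) T p x
      ext i Y g
      refine congrArg (c.1 i (e.functor.obj Y)) (Pt.ext (funext fun s => ?_))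
      exact ((e.functor.map_comp _ _).trans (congrArg _ (e.functor.map_preimage _))).symm)

lemma cohMap_cohCoeff (T : Totalization) (p : ZMod 2) (X : C) (G G' : Dᵒᵖ ⥤ ModuleCat.{w} ℂ)
    (η : G ⟶ G') (x : Coh J T p X (e.functor.op ⋙ G)) :
    cohMap e J T p X G' (cohCoeff J T p X (Functor.whiskerLeft e.functor.op η) x) =
      cohCoeff (topoEquiv e J) T p (e.functor.obj X) η (cohMap e J T p X G x) := by
  refine LinearMap.congr_fun (f := cohMap e J T p X G' ∘ₗ cohCoeff J T p X _)
    (g := cohCoeff (topoEquiv e J) T p (e.functor.obj X) η ∘ₗ cohMap e J T p X G)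
    (Coh.hom_ext fun U x => ?_) x
  obtain ⟨x, rfl⟩ := (cohRestr e.functor U.F G T p).surjective x
  rw [LinearMap.comp_apply, LinearMap.comp_apply, cohMap_toCoh]
  refine Eq.trans ?_ (cohLift_toCoh (topoEquiv e J) T p G _ _ (U.map e) x).symm
  refine (congrArg (cohMap e J T p X G') (cohLift_toCoh J T p _ _ _ U _)).trans ?_
  refine Eq.trans ?_ (cohMap_toCoh e J T p G' U _)
  refine congrArg (fun z => cohMap e J T p X G' (toCoh J T p (e.functor.op ⋙ G') U z)) ?_
  refine (cohRestr_cohFamilyMap e.functor (Family.Hom.id U.F) (Family.Hom.id (U.map e).F) η _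
    (fun j c => ?_) T p x).symm
  ext i Y g
  change (η.app (op (e.functor.obj Y))).hom (c.1 i _ _) =
    (η.app (op (e.functor.obj Y))).hom (c.1 i _ _)
  refine congrArg (fun z => (η.app (op (e.functor.obj Y))).hom (c.1 i _ z))
    (Pt.ext (funext fun s => ?_))
  change e.functor.map (g.g s) ≫ 𝟙 _ = e.functor.map (g.g s ≫ 𝟙 _)
  rw [Category.comp_id, Category.comp_id]

lemma cohMap_cohRes (T : Totalization) (p : ZMod 2) (X' X : C) (h : X' ⟶ X)
    (G : Dᵒᵖ ⥤ ModuleCat.{w} ℂ) (x : Coh J T p X (e.functor.op ⋙ G)) :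
    cohMap e J T p X' G (cohRes J T p h (e.functor.op ⋙ G) x) =
      cohRes (topoEquiv e J) T p (e.functor.map h) G (cohMap e J T p X G x) := by
  refine LinearMap.congr_fun (f := cohMap e J T p X' G ∘ₗ cohRes J T p h _)
    (g := cohRes (topoEquiv e J) T p (e.functor.map h) G ∘ₗ cohMap e J T p X G)
    (Coh.hom_ext fun U x => ?_) x
  obtain ⟨x, rfl⟩ := (cohRestr e.functor U.F G T p).surjective x
  rw [LinearMap.comp_apply, LinearMap.comp_apply, cohMap_toCoh]
  refine Eq.trans ?_ (cohLift_toCoh (topoEquiv e J) T p G _ _ (U.map e) x).symm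
  refine (congrArg (cohMap e J T p X' G) (cohLift_toCoh J T p _ _ _ U _)).trans ?_
  -- the image of the pullback of `U` refines the pullback of the image of `U`
  let ψ : ((U.F.pullback h).map e.functor).Hom
      ((U.F.map e.functor).pullback (e.functor.map h)) (𝟙 _) :=
    { idx := fun q => ⟨e.functor.obj q.1, q.2.1,
        ⟨(e.functor.map q.2.2.1.1, e.functor.map q.2.2.1.2),
        ((e.functor.map_comp _ _).symm.trans (congrArg e.functor.map q.2.2.2)).trans
          (e.functor.map_comp _ _)⟩⟩
      φ := fun q => 𝟙 _
      comm := fun q => (Category.id_comp _).trans (Category.comp_id _).symm }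
  refine Eq.trans ?_ (toCoh_refine (topoEquiv e J) T p G (V := (U.pullback h).map e)
    (U := (U.map e).pullback (e.functor.map h)) ψ _)
  refine Eq.trans ?_ (cohMap_toCoh e J T p G (U.pullback h) _)
  refine congrArg (fun z => cohMap e J T p X' G (toCoh J T p (e.functor.op ⋙ G) (U.pullback h) z))
    ?_
  let φ' : ((U.F.pullback h).map e.functor).Hom (U.F.map e.functor) (e.functor.map h) :=
    { idx := fun q => q.2.1
      φ := fun q => e.functor.map q.2.2.1.2
      comm := fun q => ((e.functor.map_comp _ _).symm.trans
        (congrArg e.functor.map q.2.2.2.symm)).trans (e.functor.map_comp _ _) }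
  refine Eq.trans (cohRestr_cohFamilyMap e.functor (U.F.pullbackHom h) φ' (𝟙 G) (𝟙 _)
    (fun j c => ?_) T p x).symm (congrArg (cohRestr e.functor (U.F.pullback h) G T p) ?_)
  · ext i Y g
    refine congrArg (c.1 ((U.F.pullbackHom h).idx ∘ i) (e.functor.obj Y))
      (Pt.ext (funext fun s => ?_))
    exact (e.functor.map_comp _ _).symm
  · refine (cohFamilyMap_triangle _ ψ φ' (𝟙 G) (𝟙 G) (𝟙 G) (fun j c => ?_) T p x).symm
    ext i Y g
    refine congrArg (c.1 (φ'.idx ∘ i) Y) (Pt.ext (funext fun s => ?_))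
    exact congrArg (· ≫ _) (Category.comp_id (g.g s))

/-- An equivalence of categories induces an isomorphism of the Čech cohomology theories. -/
def CohIso.ofEquivalence : CohIso.{w} C D where
  e := e
  topo := topoEquiv e
  mem_topo := mem_topoEquiv e
  topo_canonical := topoEquiv_canonical e
  isSheaf_iff J G := topoEquiv_isSheaf_iff e J G
  iso J T p X G := cohEquiv e J T p X G
  iso_coeff J T p X G G' η x := cohMap_cohCoeff e J T p X G G' η x
  iso_res J T p X' X h G x := cohMap_cohRes e J T p X' X h G x

end Invariance

/-! ### The Morita equivalence for modules -/

/-- The Morita equivalence between the modules over `A` and over `A ⊗ Mat_n(ℂ)`. -/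
def moduleEquivalence (A : Type u) [Ring A] [Algebra ℂ A] (n : ℕ) (i : Fin n) :
    ModuleCat.{v} A ≌ ModuleCat.{v} (A ⊗[ℂ] Matrix (Fin n) (Fin n) ℂ) :=
  (ModuleCat.matrixEquivalence A i).trans
    (ModuleCat.restrictScalarsEquivalenceOfRingEquiv
      (matrixEquivTensor (Fin n) ℂ A).symm.toRingEquiv)

/-! ### Operators on direct sums of Hilbert spaces -/

section Amplification

variable {n : ℕ} {H K L : Type v} [NormedAddCommGroup H] [InnerProductSpace ℂ H]
  [NormedAddCommGroup K] [InnerProductSpace ℂ K] [NormedAddCommGroup L] [InnerProductSpace ℂ L]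

/-- The operator `T ⊗ m` from `H ⊗ ℂ^n = H^n` to `K ⊗ ℂ^n = K^n`. -/
def ampOp (T : H →L[ℂ] K) (m : Matrix (Fin n) (Fin n) ℂ) :
    PiLp 2 (fun _ : Fin n => H) →L[ℂ] PiLp 2 (fun _ : Fin n => K) :=
  (PiLp.continuousLinearEquiv 2 ℂ (fun _ : Fin n => K)).symm.toContinuousLinearMap ∘L
    ContinuousLinearMap.pi fun i => ∑ j, m i j • T ∘L PiLp.proj 2 (fun _ : Fin n => H) j

@[simp] lemma ampOp_apply (T : H →L[ℂ] K) (m : Matrix (Fin n) (Fin n) ℂ)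
    (x : PiLp 2 (fun _ : Fin n => H)) (i : Fin n) : ampOp T m x i = ∑ j, m i j • T (x j) := by
  simp [ampOp]

lemma ampOp_comp (S : K →L[ℂ] L) (T : H →L[ℂ] K) (m m' : Matrix (Fin n) (Fin n) ℂ) :
    ampOp S m ∘L ampOp T m' = ampOp (S ∘L T) (m * m') := by
  ext x i
  simp only [ContinuousLinearMap.comp_apply, ampOp_apply, map_sum, map_smul, Matrix.mul_apply,
    Finset.smul_sum, Finset.sum_smul, smul_smul]
  exact Finset.sum_comm

lemma ampOp_adjoint [CompleteSpace H] [CompleteSpace K] (T : H →L[ℂ] K)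
    (m : Matrix (Fin n) (Fin n) ℂ) :
    ContinuousLinearMap.adjoint (ampOp T m) =
      ampOp (ContinuousLinearMap.adjoint T) m.conjTranspose := by
  refine ((ContinuousLinearMap.eq_adjoint_iff _ _).2 fun x y => ?_).symm
  simp only [PiLp.inner_apply, ampOp_apply, sum_inner, inner_sum, inner_smul_left, inner_smul_right,
    ContinuousLinearMap.adjoint_inner_left, Matrix.conjTranspose_apply, RCLike.star_def,
    RCLike.conj_conj]
  exact Finset.sum_comm

variable (n H) in
/-- The inclusion of the `i`-th summand in `H^n`. -/
def ampIncl (i : Fin n) : H →L[ℂ] PiLp 2 (fun _ : Fin n => H) :=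
  (PiLp.continuousLinearEquiv 2 ℂ (fun _ : Fin n => H)).symm.toContinuousLinearMap ∘L
    ContinuousLinearMap.single ℂ (fun _ : Fin n => H) i

@[simp] lemma ampIncl_apply (i j : Fin n) (h : H) :
    ampIncl n H i h j = (Pi.single i h : Fin n → H) j := by
  simp [ampIncl, Pi.single_apply]

lemma sum_ampIncl (x : PiLp 2 (fun _ : Fin n => H)) : ∑ i, ampIncl n H i (x i) = x := by
  ext j
  simp [Finset.sum_apply, Finset.sum_pi_single]

lemma clm_ext_ampIncl {S T : PiLp 2 (fun _ : Fin n => H) →L[ℂ] K}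
    (h : ∀ i, S ∘L ampIncl n H i = T ∘L ampIncl n H i) : S = T := by
  ext x
  rw [← sum_ampIncl x, map_sum, map_sum]
  exact Finset.sum_congr rfl fun i _ => DFunLike.congr_fun (h i) (x i)

lemma ampOp_one_apply (T : H →L[ℂ] K) (x : PiLp 2 (fun _ : Fin n => H)) (i : Fin n) :
    ampOp T 1 x i = T (x i) := by
  simp [Matrix.one_apply]

lemma ampOp_one_ampIncl (T : H →L[ℂ] K) (i : Fin n) (h : H) :
    ampOp T 1 (ampIncl n H i h) = ampIncl n K i (T h) := by
  ext j
  rw [ampOp_one_apply, ampIncl_apply, ampIncl_apply]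
  by_cases hj : j = i
  · subst hj; simp
  · simp [hj]

/-- The operator `T ⊗ E_{ij}` maps the `j`-th summand to the `i`-th summand. -/
lemma ampOp_single (T : H →L[ℂ] K) (i j : Fin n) (x : PiLp 2 (fun _ : Fin n => H)) :
    ampOp T (Matrix.single i j 1) x = ampIncl n K i (T (x j)) := by
  ext k
  rw [ampOp_apply, ampIncl_apply, Finset.sum_eq_single j]
  · by_cases h : i = k
    · subst h; simp
    · simp [h, Ne.symm h]
  · intro l _ hl
    simp [Ne.symm hl]
  · simp

end Amplification

/-! ### Generalities on `*`-representations -/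

section StarRep

variable {B : Type u} [NonUnitalRing B] [StarRing B] [Module ℂ B]

lemma StarRep.inner_π (V : StarRep.{v} B) (a : B) (h k : V.H) :
    inner ℂ (V.π a h) k = inner ℂ h (V.π (star a) k) := by
  rw [map_star, ContinuousLinearMap.star_eq_adjoint, ContinuousLinearMap.adjoint_inner_right]

lemma StarRep.clm_ext (V : StarRep.{v} B) {K : Type*} [NormedAddCommGroup K] [NormedSpace ℂ K]
    {S T : V.H →L[ℂ] K} (H : ∀ (a : B) (h : V.H), S (V.π a h) = T (V.π a h)) : S = T := by
  refine ContinuousLinearMap.ext_on V.dense ?_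
  rintro _ ⟨a, h, rfl⟩
  exact H a h

lemma StarRep.mem_of_isClosed (V : StarRep.{v} B) (S : Submodule ℂ V.H)
    (hS : IsClosed (S : Set V.H))
    (H : ∀ (a : B) (h : V.H), V.π a h ∈ S) (x : V.H) : x ∈ S := by
  have h : closure (Submodule.span ℂ {x : V.H | ∃ (a : B) (h : V.H), x = V.π a h} : Set V.H) ⊆ S :=
    hS.closure_subset_iff.2 (Submodule.span_le.2 (by rintro _ ⟨a, h, rfl⟩; exact H a h))
  exact h (V.dense x)

/-- An invertible bounded intertwining operator is an isomorphism of `*`-representations. -/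
def StarRep.isoOfEquiv {V W : StarRep.{v} B} (T : V.H ≃L[ℂ] W.H)
    (comm : ∀ (a : B) (h : V.H), T (V.π a h) = W.π a (T h)) : V ≅ W where
  hom := ⟨T, comm⟩
  inv := ⟨T.symm, fun a h => T.injective (by simp [comm])⟩
  hom_inv_id := StarRep.Hom.ext (ContinuousLinearMap.ext T.symm_apply_apply)
  inv_hom_id := StarRep.Hom.ext (ContinuousLinearMap.ext T.apply_symm_apply)

end StarRep

/-! ### Amplification of representations -/

section Amplify

variable {A : Type u} [NonUnitalCStarAlgebra A] (n : ℕ)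

variable {n} in
lemma StarRep.comm_of_tmul {V W : StarRep.{v} (A ⊗[ℂ] Matrix (Fin n) (Fin n) ℂ)}
    (T : V.H →L[ℂ] W.H)
    (H : ∀ (a : A) (m : Matrix (Fin n) (Fin n) ℂ) (h : V.H),
      T (V.π (a ⊗ₜ m) h) = W.π (a ⊗ₜ m) (T h)) (x : A ⊗[ℂ] Matrix (Fin n) (Fin n) ℂ) (h : V.H) :
    T (V.π x h) = W.π x (T h) := by
  induction x using TensorProduct.induction_on with
  | zero => simp
  | add x x' hx hx' => rw [map_add, map_add, add_apply, add_apply, map_add, hx, hx']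
  | tmul a m => exact H a m h

variable {n} in
lemma StarRep.clm_ext_tmul (V : StarRep.{v} (A ⊗[ℂ] Matrix (Fin n) (Fin n) ℂ)) {K : Type*}
    [NormedAddCommGroup K] [NormedSpace ℂ K] {S T : V.H →L[ℂ] K}
    (H : ∀ (a : A) (m : Matrix (Fin n) (Fin n) ℂ) (h : V.H),
      S (V.π (a ⊗ₜ m) h) = T (V.π (a ⊗ₜ m) h)) : S = T := by
  refine V.clm_ext fun x h => ?_
  induction x using TensorProduct.induction_on with
  | zero => simp
  | add x x' hx hx' => rw [map_add, add_apply, map_add, map_add, hx, hx']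
  | tmul a m => exact H a m h

/-- The bilinear map `(a, m) ↦ π(a) ⊗ m`. -/
def ampBilin (V : StarRep.{v} A) : A →ₗ[ℂ] Matrix (Fin n) (Fin n) ℂ →ₗ[ℂ]
    (PiLp 2 (fun _ : Fin n => V.H) →L[ℂ] PiLp 2 (fun _ : Fin n => V.H)) :=
  LinearMap.mk₂ ℂ (fun a m => ampOp (V.π a) m)
    (fun a a' m => by ext; simp [Finset.sum_add_distrib])
    (fun c a m => by ext; simp [Finset.smul_sum, smul_comm c])
    (fun a m m' => by ext; simp [add_smul, Finset.sum_add_distrib])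
    (fun c a m => by ext; simp [Finset.smul_sum, smul_smul])

lemma ampBilin_star (V : StarRep.{v} A) (x : A ⊗[ℂ] Matrix (Fin n) (Fin n) ℂ) :
    TensorProduct.lift (ampBilin n V) (star x) =
      ContinuousLinearMap.adjoint (TensorProduct.lift (ampBilin n V) x) := by
  induction x using TensorProduct.induction_on with
  | zero => rw [star_zero, map_zero, map_zero]
  | add x x' hx hx' => rw [star_add, map_add, map_add, map_add, hx, hx']
  | tmul a m =>
    rw [TensorProduct.star_tmul, TensorProduct.lift.tmul, TensorProduct.lift.tmul]
    refine Eq.trans ?_ (ampOp_adjoint (V.π a) m).symm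
    exact congrArg (fun T => ampOp T m.conjTranspose) (map_star V.π a)

/-- The action of `A ⊗ Mat_n(ℂ)` on `H ⊗ ℂ^n`. -/
def ampHom (V : StarRep.{v} A) : (A ⊗[ℂ] Matrix (Fin n) (Fin n) ℂ) →⋆ₙₐ[ℂ]
    (PiLp 2 (fun _ : Fin n => V.H) →L[ℂ] PiLp 2 (fun _ : Fin n => V.H)) where
  toFun := TensorProduct.lift (ampBilin n V)
  map_smul' c x := map_smul _ c x
  map_zero' := map_zero _
  map_add' x y := map_add _ x y
  map_mul' x y := by
    induction x using TensorProduct.induction_on with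
    | zero => simp
    | add x x' hx hx' => rw [add_mul, map_add, map_add, hx, hx', add_mul]
    | tmul a m =>
      induction y using TensorProduct.induction_on with
      | zero => simp
      | add y y' hy hy' => rw [mul_add, map_add, map_add, hy, hy', mul_add]
      | tmul a' m' =>
        rw [Algebra.TensorProduct.tmul_mul_tmul, TensorProduct.lift.tmul, TensorProduct.lift.tmul,
          TensorProduct.lift.tmul]
        refine Eq.trans ?_ (ampOp_comp (V.π a) (V.π a') m m').symm
        exact congrArg (fun T => ampOp T (m * m')) (map_mul V.π a a')
  map_star' x := ampBilin_star n V x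

lemma ampHom_tmul (V : StarRep.{v} A) (a : A) (m : Matrix (Fin n) (Fin n) ℂ) :
    ampHom n V (a ⊗ₜ m) = ampOp (V.π a) m := rfl

/-- The representation of `A ⊗ Mat_n(ℂ)` on `H ⊗ ℂ^n` for a representation of `A` on `H`. -/
def amplify (V : StarRep.{v} A) : StarRep.{v} (A ⊗[ℂ] Matrix (Fin n) (Fin n) ℂ) where
  H := PiLp 2 (fun _ : Fin n => V.H)
  π := ampHom n V
  dense := by
    set S := Submodule.span ℂ {x : PiLp 2 (fun _ : Fin n => V.H) |
      ∃ (a : A ⊗[ℂ] Matrix (Fin n) (Fin n) ℂ) (h : _), x = ampHom n V a h}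
    intro x
    change x ∈ S.topologicalClosure
    rw [← sum_ampIncl x]
    refine Submodule.sum_mem _ fun i _ => ?_
    -- the vectors `h` whose image in the `i`-th summand lies in the closure form a closed subspace
    refine V.mem_of_isClosed (S.topologicalClosure.comap (ampIncl n V.H i).toLinearMap)
      (S.isClosed_topologicalClosure.preimage (ampIncl n V.H i).continuous) (fun a h => ?_) (x i)
    refine S.le_topologicalClosure (Submodule.subset_span
      ⟨a ⊗ₜ Matrix.single i i 1, ampIncl n V.H i h, ?_⟩)
    rw [ampHom_tmul, ampOp_single]
    simp

variable (A) in
/-- Amplification of representations, as a functor. -/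
def amplifyFunctor : StarRep.{v} A ⥤ StarRep.{v} (A ⊗[ℂ] Matrix (Fin n) (Fin n) ℂ) where
  obj V := amplify n V
  map {V W} f := ⟨ampOp f.T 1, StarRep.comm_of_tmul (V := amplify n V) (W := amplify n W) _
    fun a m h => by
      have e : f.T ∘L V.π a = W.π a ∘L f.T := ContinuousLinearMap.ext (f.comm a)
      refine (DFunLike.congr_fun (ampOp_comp f.T (V.π a) 1 m) h).trans ?_
      refine Eq.trans ?_ (DFunLike.congr_fun (ampOp_comp (W.π a) f.T m 1) h).symm
      rw [e, one_mul, mul_one]⟩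
  map_id V := StarRep.Hom.ext (ContinuousLinearMap.ext fun x => by
    change ampOp (ContinuousLinearMap.id ℂ V.H) 1 x = x
    exact PiLp.ext fun i => ampOp_one_apply _ x i)
  map_comp f g := StarRep.Hom.ext (by
    refine Eq.trans ?_ (ampOp_comp g.T f.T 1 1).symm
    rw [mul_one]
    rfl)

variable {n} in
lemma amplifyFunctor_faithful (i₀ : Fin n) : (amplifyFunctor.{v} A n).Faithful where
  map_injective {V W f g} h := StarRep.Hom.ext (ContinuousLinearMap.ext fun x => by
    have h' : ampIncl n W.H i₀ (f.T x) = ampIncl n W.H i₀ (g.T x) := by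
      rw [← ampOp_one_ampIncl, ← ampOp_one_ampIncl]
      exact congrArg (fun φ : (amplifyFunctor A n).obj V ⟶ (amplifyFunctor A n).obj W =>
        φ.T (ampIncl n V.H i₀ x)) h
    simpa using congrArg (fun y : PiLp 2 (fun _ : Fin n => W.H) => y i₀) h')

variable {n} in
/-- An operator `T : H^n → K^n` that intertwines the operators `a ⊗ E_{ij}` is diagonal with equal
diagonal entries, because `T (a h)_i = (a ⊗ E_{ij}) T h_j`, where `h_i` denotes `h` in the `i`-th
summand. -/
lemma amplifyFunctor_full (i₀ : Fin n) : (amplifyFunctor.{v} A n).Full where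
  map_surjective {V W} f := by
    let T' : PiLp 2 (fun _ : Fin n => V.H) →L[ℂ] PiLp 2 (fun _ : Fin n => W.H) := f.T
    have key : ∀ (i j : Fin n) (a : A) (h : V.H),
        T' (ampIncl n V.H i (V.π a h)) = ampIncl n W.H i (W.π a (T' (ampIncl n V.H j h) j)) := by
      intro i j a h
      have := f.comm (a ⊗ₜ Matrix.single i j 1) (ampIncl n V.H j h)
      refine Eq.trans ?_ (this.trans (ampOp_single (W.π a) i j _))
      refine congrArg T' (Eq.trans ?_ (ampOp_single (V.π a) i j _).symm)
      simp
    let T : V.H →L[ℂ] W.H := PiLp.proj 2 (fun _ : Fin n => W.H) i₀ ∘L T' ∘L ampIncl n V.H i₀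
    have hT : ∀ (a : A) (h : V.H), T (V.π a h) = W.π a (T h) := by
      intro a h
      change T' (ampIncl n V.H i₀ (V.π a h)) i₀ = _
      rw [key i₀ i₀]
      simp [T]
    have hi : ∀ i, T' ∘L ampIncl n V.H i = ampIncl n W.H i ∘L T := fun i =>
      V.clm_ext fun a h => (key i i₀ a h).trans (congrArg (ampIncl n W.H i) (hT a h).symm)
    refine ⟨⟨T, hT⟩, StarRep.Hom.ext (clm_ext_ampIncl (S := ampOp T 1) (T := T') fun i => ?_)⟩
    rw [hi]
    exact ContinuousLinearMap.ext (ampOp_one_ampIncl T i)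

end Amplify

/-! ### Matrix units on a representation of `A ⊗ Mat_n(ℂ)` -/

section MatrixUnits

variable {A : Type u} [NonUnitalCStarAlgebra A] {n : ℕ}
  (W : StarRep.{v} (A ⊗[ℂ] Matrix (Fin n) (Fin n) ℂ))

lemma inner_π_tmul (a a' : A) (m m' : Matrix (Fin n) (Fin n) ℂ) (k k' : W.H) :
    inner ℂ (W.π (a ⊗ₜ m) k) (W.π (a' ⊗ₜ m') k') =
      inner ℂ k (W.π ((star a * a') ⊗ₜ (m.conjTranspose * m')) k') := by
  rw [W.inner_π, TensorProduct.star_tmul, ← mul_apply_eq_comp, ← map_mul,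
    Algebra.TensorProduct.tmul_mul_tmul]
  rfl

lemma π_tmul_π_tmul (a a' : A) (m m' : Matrix (Fin n) (Fin n) ℂ) (k : W.H) :
    W.π (a ⊗ₜ m) (W.π (a' ⊗ₜ m') k) = W.π ((a * a') ⊗ₜ (m * m')) k := by
  rw [← mul_apply_eq_comp, ← map_mul, Algebra.TensorProduct.tmul_mul_tmul]

/-- The map that sends a formal sum of triples `(a, m, k)` to the sum of the vectors
`π(a ⊗ x m) k`. -/
def leftMulMap (x : Matrix (Fin n) (Fin n) ℂ) :
    ((A × Matrix (Fin n) (Fin n) ℂ × W.H) →₀ ℂ) →ₗ[ℂ] W.H :=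
  Finsupp.linearCombination ℂ fun s => W.π (s.1 ⊗ₜ (x * s.2.1)) s.2.2

lemma leftMulMap_single (x : Matrix (Fin n) (Fin n) ℂ) (a : A) (m : Matrix (Fin n) (Fin n) ℂ)
    (k : W.H) : leftMulMap W x (Finsupp.single (a, m, k) 1) = W.π (a ⊗ₜ (x * m)) k := by
  simp [leftMulMap]

/-- The inner products of the images depend only on `x^* y`. -/
lemma inner_leftMulMap {x y x' y' : Matrix (Fin n) (Fin n) ℂ}
    (h : x.conjTranspose * y = x'.conjTranspose * y')
    (ξ η : (A × Matrix (Fin n) (Fin n) ℂ × W.H) →₀ ℂ) :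
    inner ℂ (leftMulMap W x ξ) (leftMulMap W y η) =
      inner ℂ (leftMulMap W x' ξ) (leftMulMap W y' η) := by
  simp only [leftMulMap, Finsupp.linearCombination_apply, Finsupp.sum, sum_inner, inner_sum,
    inner_smul_left, inner_smul_right, inner_π_tmul]
  refine Finset.sum_congr rfl fun s _ => congrArg _ (Finset.sum_congr rfl fun r _ => ?_)
  rw [Matrix.conjTranspose_mul, Matrix.conjTranspose_mul, Matrix.mul_assoc, Matrix.mul_assoc,
    ← Matrix.mul_assoc _ y, h, Matrix.mul_assoc x'.conjTranspose]

/-- Left multiplication by `E_{ij}` is contractive. As `E_{ij}^* E_{ij} = E_{jj} = E_{jj}^*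
E_{jj}`, the index `i` may be replaced by `j`; and `E_{jj}^* E_{jj} = 1^* E_{jj}` gives the
estimate for `E_{jj}` by the Cauchy–Schwarz inequality. -/
lemma norm_leftMulMap_single_le (i j : Fin n)
    (ξ : (A × Matrix (Fin n) (Fin n) ℂ × W.H) →₀ ℂ) :
    ‖leftMulMap W (Matrix.single i j 1) ξ‖ ≤ ‖leftMulMap W 1 ξ‖ := by
  have h1 : inner ℂ (leftMulMap W (Matrix.single i j 1) ξ) (leftMulMap W (Matrix.single i j 1) ξ) =
      inner ℂ (leftMulMap W (Matrix.single j j 1) ξ) (leftMulMap W (Matrix.single j j 1) ξ) :=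
    inner_leftMulMap W (by simp) ξ ξ
  have h2 : inner ℂ (leftMulMap W (Matrix.single j j 1) ξ) (leftMulMap W (Matrix.single j j 1) ξ) =
      inner ℂ (leftMulMap W 1 ξ) (leftMulMap W (Matrix.single j j 1) ξ) :=
    inner_leftMulMap W (by simp) ξ ξ
  have e1 : ‖leftMulMap W (Matrix.single i j 1) ξ‖ = ‖leftMulMap W (Matrix.single j j 1) ξ‖ := by
    rw [@norm_eq_sqrt_re_inner ℂ, h1, ← @norm_eq_sqrt_re_inner ℂ]
  rw [e1]
  have e2 : ‖leftMulMap W (Matrix.single j j 1) ξ‖ * ‖leftMulMap W (Matrix.single j j 1) ξ‖ ≤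
      ‖leftMulMap W 1 ξ‖ * ‖leftMulMap W (Matrix.single j j 1) ξ‖ := by
    rw [← @inner_self_eq_norm_mul_norm ℂ, h2]
    exact (RCLike.re_le_norm _).trans (norm_inner_le_norm _ _)
  by_contra! hlt
  exact absurd e2 (not_le.2 (mul_lt_mul_of_pos_right hlt ((norm_nonneg _).trans_lt hlt)))

/-- This is the non-degeneracy of the representation. -/
lemma denseRange_leftMulMap_one : DenseRange (leftMulMap W 1) := by
  intro x
  change x ∈ (LinearMap.range (leftMulMap W 1)).topologicalClosure
  refine W.mem_of_isClosed _ (Submodule.isClosed_topologicalClosure _) (fun t k => ?_) x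
  induction t using TensorProduct.induction_on with
  | zero => simp
  | add t t' ht ht' => rw [map_add]; exact add_mem ht ht'
  | tmul a m =>
    refine Submodule.le_topologicalClosure _ ⟨Finsupp.single (a, m, k) 1, ?_⟩
    rw [leftMulMap_single, one_mul]

/-- The operator by which `1 ⊗ E_{ij}` acts. It is defined although `A` need not have a unit, by
`π(a ⊗ m) k ↦ π(a ⊗ E_{ij} m) k` on a dense subspace. -/
def matUnit (i j : Fin n) : W.H →L[ℂ] W.H :=
  (leftMulMap W (Matrix.single i j 1)).extendOfNorm (leftMulMap W 1)

lemma matUnit_π (i j : Fin n) (a : A) (m : Matrix (Fin n) (Fin n) ℂ) (k : W.H) :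
    matUnit W i j (W.π (a ⊗ₜ m) k) = W.π (a ⊗ₜ (Matrix.single i j 1 * m)) k := by
  have h := LinearMap.extendOfNorm_eq (denseRange_leftMulMap_one W)
    ⟨1, fun ξ => (norm_leftMulMap_single_le W i j ξ).trans_eq (one_mul _).symm⟩
    (Finsupp.single (a, m, k) 1)
  rwa [leftMulMap_single, leftMulMap_single, one_mul] at h

lemma matUnit_matUnit_same (i j l : Fin n) (k : W.H) :
    matUnit W i j (matUnit W j l k) = matUnit W i l k := by
  have h : matUnit W i j ∘L matUnit W j l = matUnit W i l := W.clm_ext_tmul fun a m k => by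
    rw [ContinuousLinearMap.comp_apply, matUnit_π, matUnit_π, matUnit_π, ← Matrix.mul_assoc,
      Matrix.single_mul_single_same, one_mul]
  exact DFunLike.congr_fun h k

lemma matUnit_matUnit_of_ne (i l : Fin n) {j j' : Fin n} (hj : j ≠ j') (k : W.H) :
    matUnit W i j (matUnit W j' l k) = 0 := by
  have h : matUnit W i j ∘L matUnit W j' l = 0 := W.clm_ext_tmul fun a m k => by
    rw [ContinuousLinearMap.comp_apply, matUnit_π, matUnit_π, ← Matrix.mul_assoc,
      Matrix.single_mul_single_of_ne _ _ _ _ hj, zero_mul, TensorProduct.tmul_zero, map_zero]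
    rfl
  exact DFunLike.congr_fun h k

lemma sum_matUnit (k : W.H) : ∑ i, matUnit W i i k = k := by
  have h : ∑ i, matUnit W i i = ContinuousLinearMap.id ℂ W.H := W.clm_ext_tmul fun a m k => by
    rw [sum_apply]
    simp only [matUnit_π]
    rw [← sum_apply, ← map_sum, ← TensorProduct.tmul_sum, ← Finset.sum_mul,
      Matrix.sum_single_one, one_mul]
    rfl
  have := DFunLike.congr_fun h k
  rwa [sum_apply] at this

lemma π_matUnit (i j : Fin n) (a : A) (m : Matrix (Fin n) (Fin n) ℂ) (k : W.H) :
    W.π (a ⊗ₜ m) (matUnit W i j k) = W.π (a ⊗ₜ (m * Matrix.single i j 1)) k := by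
  have h : W.π (a ⊗ₜ m) ∘L matUnit W i j = W.π (a ⊗ₜ (m * Matrix.single i j 1)) :=
    W.clm_ext_tmul fun a' m' k => by
      rw [ContinuousLinearMap.comp_apply, matUnit_π, π_tmul_π_tmul, π_tmul_π_tmul, Matrix.mul_assoc]
  exact DFunLike.congr_fun h k

/-! ### The corner of a representation of `A ⊗ Mat_n(ℂ)` -/

/-- The range of the projection by which `1 ⊗ E_{ii}` acts. -/
abbrev corner (i : Fin n) : Submodule ℂ W.H :=
  LinearMap.ker (matUnit W i i - ContinuousLinearMap.id ℂ W.H).toLinearMap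

lemma mem_corner (i : Fin n) (k : W.H) : k ∈ corner W i ↔ matUnit W i i k = k := by
  rw [LinearMap.mem_ker]
  exact sub_eq_zero

lemma isClosed_corner (i : Fin n) : IsClosed (corner W i : Set W.H) :=
  (matUnit W i i - ContinuousLinearMap.id ℂ W.H).isClosed_ker

lemma matUnit_mem_corner (i j : Fin n) (k : W.H) : matUnit W i j k ∈ corner W i :=
  (mem_corner W i _).2 (matUnit_matUnit_same W i i j k)

/-- `A` acts on the corner, by the operators `a ⊗ E_{ii}`. -/
def cornerOp (i : Fin n) (a : A) : corner W i →L[ℂ] corner W i :=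
  (W.π (a ⊗ₜ Matrix.single i i 1) ∘L (corner W i).subtypeL).codRestrict (corner W i) fun k => by
    rw [mem_corner]
    exact (matUnit_π W i i a _ _).trans (by rw [Matrix.single_mul_single_same, one_mul]; rfl)

lemma cornerOp_apply (i : Fin n) (a : A) (k : corner W i) :
    (cornerOp W i a k : W.H) = W.π (a ⊗ₜ Matrix.single i i 1) k := rfl

instance (i : Fin n) : CompleteSpace (corner W i) := (isClosed_corner W i).completeSpace_coe

/-- The representation of `A` on the corner. -/
def cornerHom (i : Fin n) : A →⋆ₙₐ[ℂ] (corner W i →L[ℂ] corner W i) where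
  toFun := cornerOp W i
  map_smul' c a := by
    ext k
    simp [cornerOp_apply, ← TensorProduct.smul_tmul']
  map_zero' := by
    ext k
    simp [cornerOp_apply]
  map_add' a a' := by
    ext k
    simp [cornerOp_apply, TensorProduct.add_tmul]
  map_mul' a a' := by
    ext k
    rw [mul_apply_eq_comp, cornerOp_apply, cornerOp_apply, cornerOp_apply, π_tmul_π_tmul,
      Matrix.single_mul_single_same, one_mul]
  map_star' a := by
    rw [ContinuousLinearMap.star_eq_adjoint]
    refine (ContinuousLinearMap.eq_adjoint_iff _ _).2 fun x y => ?_
    rw [Submodule.coe_inner, Submodule.coe_inner, cornerOp_apply, cornerOp_apply, W.inner_π,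
      TensorProduct.star_tmul, star_star, Matrix.star_eq_conjTranspose,
      Matrix.conjTranspose_single, star_one]

/-- The corner `(1 ⊗ E_{ii}) W`, as a representation of `A`. -/
def cornerRep (i : Fin n) : StarRep.{v} A where
  H := corner W i
  π := cornerHom W i
  dense := by
    set S := Submodule.span ℂ {x : corner W i | ∃ (a : A) (h : _), x = cornerHom W i a h}
    -- the projection onto the corner maps the dense subspace of `W` into the closure of the span
    let P : W.H →L[ℂ] corner W i := (matUnit W i i).codRestrict (corner W i)
      (matUnit_mem_corner W i i)
    intro x
    have hx : P x = x := Subtype.ext ((mem_corner W i _).1 x.2)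
    change x ∈ S.topologicalClosure
    rw [← hx]
    refine W.mem_of_isClosed (S.topologicalClosure.comap P.toLinearMap)
      (S.isClosed_topologicalClosure.preimage P.continuous) (fun t k => ?_) x
    induction t using TensorProduct.induction_on with
    | zero => simp
    | add t t' ht ht' => rw [map_add]; exact add_mem ht ht'
    | tmul a m =>
      refine S.le_topologicalClosure ?_
      have e : P (W.π (a ⊗ₜ m) k) =
          ∑ j, m i j • cornerHom W i a ⟨matUnit W i j k, matUnit_mem_corner W i j k⟩ := by
        ext
        have h : ∀ j, (cornerHom W i a ⟨matUnit W i j k, matUnit_mem_corner W i j k⟩ : W.H) =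
            W.π (a ⊗ₜ Matrix.single i j 1) k := fun j =>
          (π_matUnit W i j a _ k).trans (by rw [Matrix.single_mul_single_same, one_mul])
        have hm : Matrix.single i i 1 * m = ∑ j, m i j • Matrix.single i j (1 : ℂ) := by
          ext r s
          rw [Matrix.sum_apply]
          by_cases hr : r = i
          · subst hr
            simp [Matrix.single_apply]
          · simp [Ne.symm hr, hr]
        refine (matUnit_π W i i a m k).trans ?_
        simp only [hm, TensorProduct.tmul_sum, map_sum, sum_apply, TensorProduct.tmul_smul,
          map_smul, smul_apply, AddSubmonoidClass.coe_finsetSum, Submodule.coe_smul, h]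
      exact e ▸ Submodule.sum_mem _ fun j _ =>
        Submodule.smul_mem _ _ (Submodule.subset_span ⟨a, _, rfl⟩)

/-- A representation of `A ⊗ Mat_n(ℂ)` is the direct sum of `n` copies of its corner, which the
matrix units identify with each other. -/
def cornerEquiv (i₀ : Fin n) : PiLp 2 (fun _ : Fin n => corner W i₀) ≃L[ℂ] W.H :=
  ContinuousLinearEquiv.equivOfInverse
    (∑ i, matUnit W i i₀ ∘L (corner W i₀).subtypeL ∘L PiLp.proj 2 (fun _ : Fin n => corner W i₀) i)
    (∑ i, ampIncl n (corner W i₀) i ∘L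
      (matUnit W i₀ i).codRestrict (corner W i₀) (matUnit_mem_corner W i₀ i))
    (fun x => by
      refine PiLp.ext fun j => Subtype.ext ?_
      have h : ∀ i, matUnit W i₀ j (matUnit W i i₀ (x i)) = if j = i then (x i : W.H) else 0 := by
        intro i
        split_ifs with h
        · subst h
          rw [matUnit_matUnit_same, (mem_corner W i₀ _).1 (x j).2]
        · exact matUnit_matUnit_of_ne W _ _ h _
      simp [sum_apply, Finset.sum_apply, Finset.sum_pi_single, h])
    (fun k => by
      have h : ∀ i, matUnit W i i₀ (matUnit W i₀ i k) = matUnit W i i k := fun i =>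
        matUnit_matUnit_same W i i₀ i k
      refine Eq.trans ?_ (sum_matUnit W k)
      rw [sum_apply, sum_apply]
      refine Finset.sum_congr rfl fun j _ => ?_
      rw [← h]
      exact congrArg (fun y : PiLp 2 (fun _ : Fin n => corner W i₀) => matUnit W j i₀ (y j))
        (sum_ampIncl (WithLp.toLp 2 fun i =>
          (⟨matUnit W i₀ i k, matUnit_mem_corner W i₀ i k⟩ : corner W i₀))))

lemma cornerEquiv_apply (i₀ : Fin n) (x : PiLp 2 (fun _ : Fin n => corner W i₀)) :
    cornerEquiv W i₀ x = ∑ i, matUnit W i i₀ (x i) := by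
  change (∑ i, matUnit W i i₀ ∘L (corner W i₀).subtypeL ∘L
    PiLp.proj 2 (fun _ : Fin n => corner W i₀) i) x = _
  rw [sum_apply]
  rfl

/-- The identification of `n` copies of the corner with `W` intertwines the actions. -/
lemma cornerEquiv_comm (i₀ : Fin n) (a : A) (m : Matrix (Fin n) (Fin n) ℂ)
    (x : PiLp 2 (fun _ : Fin n => corner W i₀)) :
    cornerEquiv W i₀ (ampOp (cornerHom W i₀ a) m x) = W.π (a ⊗ₜ m) (cornerEquiv W i₀ x) := by
  have h : ∀ i j, matUnit W i i₀ (cornerHom W i₀ a (x j) : W.H) =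
      W.π (a ⊗ₜ Matrix.single i i₀ 1) (x j) := fun i j =>
    (matUnit_π W i i₀ a _ _).trans (by rw [Matrix.single_mul_single_same, one_mul]; rfl)
  have hm : ∀ j, m * Matrix.single j i₀ 1 = ∑ i, m i j • Matrix.single i i₀ (1 : ℂ) := by
    intro j
    ext r s
    rw [Matrix.sum_apply]
    by_cases hs : s = i₀
    · subst hs
      simp [Matrix.single_apply]
    · simp [Ne.symm hs, hs]
  rw [cornerEquiv_apply, cornerEquiv_apply, map_sum]
  simp only [π_matUnit, hm, TensorProduct.tmul_sum, map_sum, sum_apply, TensorProduct.tmul_smul,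
    map_smul, smul_apply, ampOp_apply, AddSubmonoidClass.coe_finsetSum, Submodule.coe_smul, h]
  exact Finset.sum_comm

/-- A representation of `A ⊗ Mat_n(ℂ)` is isomorphic to the amplification of its corner. -/
lemma amplifyFunctor_essSurj (i₀ : Fin n) : (amplifyFunctor.{v} A n).EssSurj where
  mem_essImage W := ⟨cornerRep W i₀, ⟨StarRep.isoOfEquiv (V := amplify n (cornerRep W i₀))
    (cornerEquiv W i₀) (StarRep.comm_of_tmul (V := amplify n (cornerRep W i₀))
      (cornerEquiv W i₀).toContinuousLinearMap (cornerEquiv_comm W i₀))⟩⟩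

variable (A) in
/-- The Morita equivalence between the representations of `A` and of `A ⊗ Mat_n(ℂ)`. -/
def starRepEquivalence (i₀ : Fin n) :
    StarRep.{v} A ≌ StarRep.{v} (A ⊗[ℂ] Matrix (Fin n) (Fin n) ℂ) :=
  have := amplifyFunctor_faithful (A := A) i₀
  have := amplifyFunctor_full (A := A) i₀
  have := amplifyFunctor_essSurj (A := A) i₀
  have : (amplifyFunctor.{v} A n).IsEquivalence := {}
  (amplifyFunctor.{v} A n).asEquivalence

end MatrixUnits

end CechZ2

end

theorem mainTheorem2 (n : ℕ) (hn : 1 ≤ n) :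
    (∀ (A : Type u) [Ring A] [Algebra ℂ A],
      Nonempty (CechZ2.CohIso.{w} (ModuleCat.{v} A)
        (ModuleCat.{v} (A ⊗[ℂ] Matrix (Fin n) (Fin n) ℂ)))) ∧
    (∀ (A : Type u) [NonUnitalCStarAlgebra A],
      Nonempty (CechZ2.CohIso.{w} (CechZ2.StarRep.{v} A)
        (CechZ2.StarRep.{v} (A ⊗[ℂ] Matrix (Fin n) (Fin n) ℂ)))) :=
  ⟨fun A _ _ => ⟨.ofEquivalence (CechZ2.moduleEquivalence A n ⟨0, hn⟩)⟩,
    fun A _ => ⟨.ofEquivalence (CechZ2.starRepEquivalence A ⟨0, hn⟩)⟩⟩
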